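/- Let $(V,Y,\mathbf 1,\omega)$ be a vertex operator algebra over $\mathbb C$ (in the usual sense: $\mathbb Z$-graded by the eigenvalues of $L(0)=\omega_{(1)}$, with finite-dimensional weight spaces $V_n$ that vanish for $n\ll 0$), and let $g$ be an automorphism of $V$ of finite order $|g|$. Write $Y(a,z)=\sum_{n\in\mathbb Z}a_{(n)}z^{-n-1}$ and $V^r=\{a\in V: ga=e^{2\pi i r/|g|}a\}$. A weak $g$-twisted $V$-module is a complex vector space $W$ with a linear map $a\mapsto Y_W(a,z)=\sum_{n\in\frac1{|g|}\mathbb Z}a_{(n)}z^{-n-1}$, $a_{(n)}\in\mathrm{End}(W)$, such that only exponents $n\in \frac r{|g|}+\mathbb Z$ occur for $a\in V^r$; $a_{(n)}w=0$ for $n\gg0$ for all $a\in V$, $w\in W$; $Y_W(\mathbf 1,z)=\mathrm{id}_W$; and, for $a\in V^r$ and $b\in V$, the $g$-twisted Jacobi identity holds: $$z_0^{-1}\delta\Big(\frac{z_1-z_2}{z_0}\Big)Y_W(a,z_1)Y_W(b,z_2)-z_0^{-1}\delta\Big(\frac{-z_2+z_1}{z_0}\Big)Y_W(b,z_2)Y_W(a,z_1)=z_2^{-1}\delta\Big(\frac{z_1-z_0}{z_2}\Big)\Big(\frac{z_1-z_0}{z_2}\Big)^{-r/|g|}Y_W(Y(a,z_0)b,z_2).$$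 It is admissible if it carries a grading $W=\bigoplus_{n\in\frac1{|g|}\mathbb N}W(n)$ with $a_{(m)}W(n)\subseteq W(n+k-m-1)$ for all $a\in V_k$ (where $W(q)=0$ for $q\notin\frac1{|g|}\mathbb N$). It is ordinary if it is the direct sum of the eigenspaces $W_s$ ($s\in\mathbb C$) of $L(0)=\omega_{(1)}$, all $W_s$ are finite-dimensional, and for each $s$ one has $W_{s+n/|g|}=0$ for all sufficiently small integers $n$. A weak module is irreducible if it is nonzero and has no submodules other than $0$ and itself; an admissible module is irreducible if it is nonzero and has no graded submodules other than $0$ and itself. The algebra $V$ is $g$-rational if every admissible $g$-twisted $V$-module is a direct sum of irreducible admissible $g$-twisted $V$-modules, and $g$-regular if every weak $g$-twisted $V$-module is a direct sum of irreducible ordinary $g$-twisted $V$-modules. It is of CFT type if $V_n=0$ for $n<0$ and $V_0=\mathbb C\mathbf 1$, and $C_2$-cofinite if $V/\langle a_{(-2)}b: a,b\in V\rangle$ is finite-dimensional. **Theorem.** If $V$ is of CFT type, $C_2$-cofinite and $g$-rational, then $V$ is $g$-regular. -/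

import Mathlib

universe u v

/-- A vertex operator algebra structure on a complex vector space `V`.
`Y a n` is the mode `a_(n)` in `Y(a, z) = ∑ a_(n) z ^ (-n-1)`. -/
structure VertexOperatorAlgebra (V : Type u) [AddCommGroup V] [Module ℂ V] where
  /-- The modes of the vertex operators. -/
  Y : V →ₗ[ℂ] (ℤ → Module.End ℂ V)
  /-- The vacuum vector. -/
  vacuum : V
  /-- The conformal (Virasoro) vector. -/
  conformal : V
  /-- The central charge. -/
  centralCharge : ℂ
  truncation : ∀ a b : V, ∃ N : ℤ, ∀ n : ℤ, N ≤ n → Y a n b = 0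
  vacuum_left : ∀ (n : ℤ) (b : V), Y vacuum n b = if n = -1 then b else 0
  creation : ∀ a : V, Y a (-1) vacuum = a
  creation_nonneg : ∀ (a : V) (n : ℤ), 0 ≤ n → Y a n vacuum = 0
  /-- The Jacobi identity, in components: the coefficient extracted by
  `Res_{z₀} Res_{z₁} Res_{z₂} z₀ ^ p z₁ ^ m z₂ ^ n`. All sums are finite by truncation. -/
  jacobi : ∀ (a b c : V) (m n p : ℤ),
    (∑ᶠ j : ℕ, ((-1 : ℂ) ^ j * (Ring.choose p j : ℤ)) • Y a (m + p - j) (Y b (n + j) c)) -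
      (∑ᶠ j : ℕ, ((-1 : ℂ) ^ p * (-1 : ℂ) ^ j * (Ring.choose p j : ℤ)) •
        Y b (n + p - j) (Y a (m + j) c)) =
    ∑ᶠ j : ℕ, ((Ring.choose m j : ℤ) : ℂ) • Y (Y a (p + j) b) (m + n - j) c
  /-- `L(n) = conformal_(n+1)` satisfy the Virasoro relations. -/
  virasoro : ∀ (m n : ℤ) (b : V),
    Y conformal (m + 1) (Y conformal (n + 1) b) - Y conformal (n + 1) (Y conformal (m + 1) b) =
      ((m : ℂ) - n) • Y conformal (m + n + 1) b +
        (if m + n = 0 then ((m : ℂ) ^ 3 - m) / 12 * centralCharge else 0) • b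
  /-- `Y(L(-1)a, z) = d/dz Y(a, z)`. -/
  derivative : ∀ (a : V) (n : ℤ), Y (Y conformal 0 a) n = (-(n : ℂ)) • Y a (n - 1)
  /-- `V` is the direct sum of its weight spaces `V_n = {a | L(0)a = na}`, `n ∈ ℤ`. -/
  grading : DirectSum.IsInternal fun n : ℤ => (Y conformal 1).eigenspace (n : ℂ)
  finite_weight : ∀ n : ℤ, FiniteDimensional ℂ ((Y conformal 1).eigenspace (n : ℂ))
  weight_bounded_below : ∃ N : ℤ, ∀ n : ℤ, n < N → (Y conformal 1).eigenspace (n : ℂ) = ⊥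

namespace VertexOperatorAlgebra

variable {V : Type u} [AddCommGroup V] [Module ℂ V]

/-- The weight space `V_n = {a | L(0)a = na}`, where `L(0) = conformal_(1)`. -/
def weightSpace (S : VertexOperatorAlgebra V) (n : ℤ) : Submodule ℂ V :=
  (S.Y S.conformal 1).eigenspace (n : ℂ)

/-- `V` is of CFT type: no negative weights, and `V_0` is spanned by the vacuum. -/
def IsCFTType (S : VertexOperatorAlgebra V) : Prop :=
  (∀ n : ℤ, n < 0 → S.weightSpace n = ⊥) ∧ S.weightSpace 0 = Submodule.span ℂ {S.vacuum}

/-- `C_2(V)`, the linear span of all `a_(-2) b`. -/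
def C2 (S : VertexOperatorAlgebra V) : Submodule ℂ V :=
  Submodule.span ℂ {x | ∃ a b : V, x = S.Y a (-2) b}

/-- `V` is `C_2`-cofinite: `V / C_2(V)` is finite dimensional. -/
def IsC2Cofinite (S : VertexOperatorAlgebra V) : Prop :=
  FiniteDimensional ℂ (V ⧸ S.C2)

/-- A linear automorphism of `V` is a VOA automorphism if it preserves the vertex operators, the
vacuum and the conformal vector. -/
structure IsAutomorphism (S : VertexOperatorAlgebra V) (g : V ≃ₗ[ℂ] V) : Prop where
  map_mode : ∀ (a b : V) (n : ℤ), g (S.Y a n b) = S.Y (g a) n (g b)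
  map_vacuum : g S.vacuum = S.vacuum
  map_conformal : g S.conformal = S.conformal

end VertexOperatorAlgebra

/-- The eigenspace `V^r = {a | g a = exp(2πi r/|g|) a}`; it depends only on `r` modulo `|g|`. -/
noncomputable def gEigenspace {V : Type u} [AddCommGroup V] [Module ℂ V] (g : V ≃ₗ[ℂ] V) (r : ℤ) :
    Submodule ℂ V :=
  Module.End.eigenspace (g : Module.End ℂ V)
    (Complex.exp (2 * Real.pi * Complex.I * r / orderOf g))

/-- A weak `g`-twisted module structure on a complex vector space `W`, for an automorphism `g` of
finite order. `Y a q` is the mode `a_(q)` in `Y_W(a, z) = ∑ a_(q) z ^ (-q-1)`; the exponents lie in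
`(1/|g|)ℤ` by `mode_support`. -/
structure WeakTwistedModule {V : Type u} [AddCommGroup V] [Module ℂ V]
    (S : VertexOperatorAlgebra V) (g : V ≃ₗ[ℂ] V)
    (W : Type v) [AddCommGroup W] [Module ℂ W] where
  /-- The modes of the twisted vertex operators. -/
  Y : V →ₗ[ℂ] (ℚ → Module.End ℂ W)
  /-- For `a ∈ V^r`, only modes `a_(q)` with `q ∈ r/|g| + ℤ` occur. -/
  mode_support : ∀ (r : ℤ), ∀ a ∈ gEigenspace g r, ∀ q : ℚ,
    (∀ k : ℤ, q ≠ (r : ℚ) / orderOf g + k) → Y a q = 0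
  truncation : ∀ (a : V) (w : W), ∃ N : ℚ, ∀ q : ℚ, N ≤ q → Y a q w = 0
  vacuum : ∀ (q : ℚ) (w : W), Y S.vacuum q w = if q = -1 then w else 0
  /-- The `g`-twisted Jacobi identity, in components: for `a ∈ V^r` and `m ∈ r/|g| + ℤ`, the
  coefficient extracted by `Res_{z₀} Res_{z₁} Res_{z₂} z₀ ^ p z₁ ^ m z₂ ^ n`.
  All sums are finite by truncation. -/
  jacobi : ∀ (r : ℤ), ∀ a ∈ gEigenspace g r, ∀ (b : V) (w : W) (k p : ℤ) (m n : ℚ),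
    m = (r : ℚ) / orderOf g + k →
    (∑ᶠ j : ℕ, ((-1 : ℂ) ^ j * (Ring.choose p j : ℤ)) • Y a (m + p - j) (Y b (n + j) w)) -
      (∑ᶠ j : ℕ, ((-1 : ℂ) ^ p * (-1 : ℂ) ^ j * (Ring.choose p j : ℤ)) •
        Y b (n + p - j) (Y a (m + j) w)) =
    ∑ᶠ j : ℕ, ((Ring.choose m j : ℚ) : ℂ) • Y (S.Y a (p + j) b) (m + n - j) w

namespace WeakTwistedModule

variable {V : Type u} [AddCommGroup V] [Module ℂ V] {S : VertexOperatorAlgebra V} {g : V ≃ₗ[ℂ] V}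
  {W : Type v} [AddCommGroup W] [Module ℂ W]

/-- A subspace closed under all modes, that is, a (weak) submodule. -/
def IsSubmodule (M : WeakTwistedModule S g W) (N : Submodule ℂ W) : Prop :=
  ∀ (a : V) (q : ℚ), ∀ w ∈ N, M.Y a q w ∈ N

/-- The weak `g`-twisted module structure on a submodule. -/
def restrict (M : WeakTwistedModule S g W) (N : Submodule ℂ W) (hN : M.IsSubmodule N) :
    WeakTwistedModule S g N where
  Y :=
    { toFun := fun a q => (M.Y a q).restrict (hN a q)
      map_add' := fun a b => by
        funext q; ext w; simp
      map_smul' := fun c a => by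
        funext q; ext w; simp }
  mode_support := fun r a ha q hq => by
    ext w
    simp [M.mode_support r a ha q hq]
  truncation := fun a w => by
    obtain ⟨B, hB⟩ := M.truncation a w
    exact ⟨B, fun q hq => Subtype.ext (by simpa using hB q hq)⟩
  vacuum := fun q w => by
    apply Subtype.ext
    have h := M.vacuum q w
    split_ifs with hq <;> simpa [hq] using h
  jacobi := fun r a ha b w k p m n hm => by
    apply Subtype.ext
    have hinj : Function.Injective N.subtype.toAddMonoidHom := N.injective_subtype
    have e : ∀ f : ℕ → N, ((∑ᶠ j, f j : N) : W) = ∑ᶠ j, (f j : W) := fun f =>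
      AddMonoidHom.map_finsum_of_injective N.subtype.toAddMonoidHom hinj f
    have h := M.jacobi r a ha b w k p m n hm
    simpa [e] using h

/-- A weak twisted module is irreducible if it is nonzero and has no submodules besides zero and
itself. -/
def IsIrreducible (M : WeakTwistedModule S g W) : Prop :=
  Nontrivial W ∧ ∀ N : Submodule ℂ W, M.IsSubmodule N → N = ⊥ ∨ N = ⊤

/-- `gr` is a grading `W = ⊕ W(q)`, `q ∈ (1/|g|)ℕ`, making the module admissible:
`a_(m) W(q) ⊆ W(q + wt a - m - 1)`. -/
structure IsAdmissibleGrading (M : WeakTwistedModule S g W) (gr : ℚ → Submodule ℂ W) : Prop where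
  internal : DirectSum.IsInternal gr
  support : ∀ q : ℚ, (∀ k : ℕ, q ≠ (k : ℚ) / orderOf g) → gr q = ⊥
  mode_mem : ∀ (h : ℤ), ∀ a ∈ S.weightSpace h, ∀ (m q : ℚ), ∀ w ∈ gr q,
    M.Y a m w ∈ gr (q + h - m - 1)

/-- A weak twisted module is admissible if it carries an admissible grading. -/
def IsAdmissible (M : WeakTwistedModule S g W) : Prop :=
  ∃ gr : ℚ → Submodule ℂ W, M.IsAdmissibleGrading gr

/-- An irreducible admissible module: a nonzero admissible module with no graded submodules besides
zero and itself. -/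
def IsIrreducibleAdmissible (M : WeakTwistedModule S g W) : Prop :=
  Nontrivial W ∧ ∃ gr : ℚ → Submodule ℂ W, M.IsAdmissibleGrading gr ∧
    ∀ N : Submodule ℂ W, M.IsSubmodule N → N = ⨆ q : ℚ, N ⊓ gr q → N = ⊥ ∨ N = ⊤

/-- The `L(0)`-weight space `W_s = {w | L(0)w = sw}`, where `L(0) = conformal_(1)`. -/
def weightSpace (M : WeakTwistedModule S g W) (s : ℂ) : Submodule ℂ W :=
  (M.Y S.conformal 1).eigenspace s

/-- An ordinary twisted module: `W` is the direct sum of its `L(0)`-weight spaces `W_s`, each of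
these is finite dimensional, and for each `s`, `W_{s + n/|g|} = 0` for all sufficiently small
integers `n`. -/
structure IsOrdinary (M : WeakTwistedModule S g W) : Prop where
  internal : DirectSum.IsInternal M.weightSpace
  finite_weight : ∀ s : ℂ, FiniteDimensional ℂ (M.weightSpace s)
  bounded_below : ∀ s : ℂ, ∃ B : ℤ, ∀ n : ℤ, n < B →
    M.weightSpace (s + (n : ℂ) / orderOf g) = ⊥

end WeakTwistedModule

namespace VertexOperatorAlgebra

variable {V : Type u} [AddCommGroup V] [Module ℂ V]

open Classical in
/-- `V` is `g`-rational: every admissible `g`-twisted module is a direct sum of irreducible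
admissible `g`-twisted modules. -/
def IsGRational (S : VertexOperatorAlgebra V) (g : V ≃ₗ[ℂ] V) : Prop :=
  ∀ (W : Type v) [AddCommGroup W] [Module ℂ W] (M : WeakTwistedModule S g W), M.IsAdmissible →
    ∃ (ι : Type v) (N : ι → Submodule ℂ W) (hN : ∀ i, M.IsSubmodule (N i)),
      DirectSum.IsInternal N ∧ ∀ i, (M.restrict (N i) (hN i)).IsIrreducibleAdmissible

open Classical in
/-- `V` is `g`-regular: every weak `g`-twisted module is a direct sum of irreducible ordinary
`g`-twisted modules. -/
def IsGRegular (S : VertexOperatorAlgebra V) (g : V ≃ₗ[ℂ] V) : Prop :=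
  ∀ (W : Type v) [AddCommGroup W] [Module ℂ W] (M : WeakTwistedModule S g W),
    ∃ (ι : Type v) (N : ι → Submodule ℂ W) (hN : ∀ i, M.IsSubmodule (N i)),
      DirectSum.IsInternal N ∧
        ∀ i, (M.restrict (N i) (hN i)).IsIrreducible ∧ (M.restrict (N i) (hN i)).IsOrdinary

end VertexOperatorAlgebra

/-! ### Splitting initial terms off finite sums over ℕ -/

section Finsum

variable {W : Type*} [AddCommGroup W]

/-! The core is a spanning theorem, `monomial_mem_reducedSpan`. Lift a basis of V/C_2(V) to finitely
many vectors homogeneous for both L(0) and g, and let w be any vector of a weak module. Every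
product of modes applied to w is a combination of products, of the same degree, of modes of these
generators whose indices lie in (1/|g|)ℤ, stay below a bound N, and differ pairwise by at least 1.
This last condition replaces the distinct indices of the untwisted case. Separation makes the degree
grow quadratically in the length, so each degree admits finitely many products and the degrees are
bounded below (`degreeSpace_finite`).

Consequently L(0) preserves the finite-dimensional space of degree 0 containing w, so w is a sum of
generalized L(0)-eigenvectors. The submodule generated by one such vector is graded by degree,
because different degrees lie in different generalized eigenspaces, and is therefore admissible
(`generate_isAdmissible`). By g-rationality it is a direct sum of irreducible admissible modules.

These are irreducible even among non-graded submodules (`IsIrreducibleAdmissible.isIrreducible`):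
every nonzero submodule contains an L(0)-eigenvector, and eigenvectors there are homogeneous. Hence
W is a sum of simple modules over the algebra generated by the modes, so it is a direct sum of such.
Each summand is generated by an L(0)-eigenvector, so its weight spaces are degree spaces and the
finiteness above makes it ordinary (`IsIrreducible.isOrdinary`). -/

theorem Submodule.finsum_mem_of_forall [Module ℂ W] {ι : Sort*} (D : Submodule ℂ W) {f : ι → W}
    (h : ∀ i, f i ∈ D) : ∑ᶠ i, f i ∈ D :=
  finsum_induction (· ∈ D) D.zero_mem (fun _ _ => D.add_mem) h

theorem finsum_nat_eq_zero_add {f : ℕ → W} {n : ℕ} (hf : ∀ j, n ≤ j → f j = 0) :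
    ∑ᶠ j, f j = f 0 + ∑ᶠ j, f (j + 1) := by
  rw [finsum_eq_sum_of_support_subset (s := Finset.range (n + 1)) f,
    finsum_eq_sum_of_support_subset (s := Finset.range n) fun j => f (j + 1),
    Finset.sum_range_succ', add_comm]
  · intro j hj
    by_contra hlt
    exact hj (hf _ (by simp at hlt; omega))
  · intro j hj
    by_contra hlt
    exact hj (hf _ (by simp at hlt; omega))

theorem finsum_nat_eq_zero_add_one {f : ℕ → W} (hf : ∀ j, f (j + 2) = 0) :
    ∑ᶠ j, f j = f 0 + f 1 := by
  have h2 : ∀ j, 2 ≤ j → f j = 0 := fun j hj => by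
    obtain ⟨i, rfl⟩ := Nat.exists_eq_add_of_le' hj
    exact hf i
  rw [finsum_nat_eq_zero_add h2, finsum_eq_single _ 0]
  intro j hj
  exact h2 _ (by omega)

theorem finsum_nat_eq_zero {f : ℕ → W} (hf : ∀ j, f (j + 1) = 0) :
    ∑ᶠ j, f j = f 0 :=
  finsum_eq_single _ 0 fun j hj => by
    obtain ⟨i, rfl⟩ := Nat.exists_eq_succ_of_ne_zero hj
    exact hf i

end Finsum

theorem ringChoose_one_add_two {R : Type*} [CommRing R] [BinomialRing R] (j : ℕ) :
    Ring.choose (1 : R) (j + 2) = 0 := by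
  have := Ring.choose_natCast (R := R) 1 (j + 2)
  rw [Nat.cast_one] at this
  rw [this, Nat.choose_eq_zero_of_lt (by omega), Nat.cast_zero]

/-! ### Weights of modes in V -/

namespace VertexOperatorAlgebra

variable {V : Type u} [AddCommGroup V] [Module ℂ V] (S : VertexOperatorAlgebra V)

theorem mem_weightSpace {a : V} {h : ℤ} :
    a ∈ S.weightSpace h ↔ S.Y S.conformal 1 a = (h : ℂ) • a := Module.End.mem_eigenspace_iff

theorem commutator_conformal_one (a c : V) (n : ℤ) :
    S.Y S.conformal 1 (S.Y a n c) - S.Y a n (S.Y S.conformal 1 c) =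
      (-((n : ℂ) + 1)) • S.Y a n c + S.Y (S.Y S.conformal 1 a) n c := by
  have h := S.jacobi S.conformal a c 1 n 0
  rw [finsum_nat_eq_zero (by simp [Ring.choose_zero_succ]),
    finsum_nat_eq_zero (by simp [Ring.choose_zero_succ]),
    finsum_nat_eq_zero_add_one (by simp [ringChoose_one_add_two])] at h
  simp only [Ring.choose_zero_right, Ring.choose_one_right] at h
  simp only [pow_zero, Int.cast_one, mul_one, one_smul, Nat.cast_zero, sub_zero,
    add_zero, zpow_zero, Nat.cast_one, zero_add, add_sub_cancel_left] at h
  rw [h, S.derivative]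
  simp [add_comm]

theorem mode_mem_weightSpace {a b : V} {h k : ℤ} (ha : a ∈ S.weightSpace h)
    (hb : b ∈ S.weightSpace k) (n : ℤ) : S.Y a n b ∈ S.weightSpace (h + k - n - 1) := by
  rw [mem_weightSpace] at *
  have e := S.commutator_conformal_one a b n
  rw [ha, hb, sub_eq_iff_eq_add] at e
  rw [e]
  simp only [map_smul, Pi.smul_apply, LinearMap.smul_apply]
  push_cast
  module

theorem conformal_mem_weightSpace : S.conformal ∈ S.weightSpace 2 := by
  rw [mem_weightSpace]
  have h := S.virasoro 0 (-2) S.vacuum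
  have h1 := S.creation S.conformal
  have h2 := S.creation_nonneg S.conformal 1 (by norm_num)
  norm_num [h1, h2] at h
  simpa using h

theorem conformal_zero_eq (a : V) : S.Y S.conformal 0 a = S.Y a (-2) S.vacuum := by
  have h := congrArg (fun f : Module.End ℂ V => f S.vacuum) (S.derivative a (-1))
  simpa [S.creation] using h

end VertexOperatorAlgebra

/-! ### Simultaneous eigenvectors of L(0) and g, and generators modulo C_2(V) -/

/-- Discrete Fourier inversion over the cyclic group generated by G. The components are polynomials
in G applied to a, so they remain in every G-stable subspace; with p a weight space this
diagonalizes L(0) and g together. -/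
theorem Module.End.mem_iSup_eigenspace_of_pow_eq_one {V : Type*} [AddCommGroup V] [Module ℂ V]
    {G : Module.End ℂ V} {T : ℕ} (hT : 0 < T) (hG : G ^ T = 1) {p : Submodule ℂ V}
    (hp : ∀ a ∈ p, G a ∈ p) {a : V} (ha : a ∈ p) :
    a ∈ ⨆ r : ℤ, p ⊓ G.eigenspace (Complex.exp (2 * Real.pi * Complex.I * r / T)) := by
  set ζ : ℂ := Complex.exp (2 * Real.pi * Complex.I / T) with hζ
  have hprim : IsPrimitiveRoot ζ T := Complex.isPrimitiveRoot_exp T hT.ne'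
  have hexp : ∀ r : ℤ, Complex.exp (2 * Real.pi * Complex.I * r / T) = ζ ^ r := fun r => by
    rw [hζ, ← Complex.exp_int_mul]
    congr 1
    ring
  have hζ0 : ζ ≠ 0 := hprim.ne_zero hT.ne'
  have hpow : ∀ k : ℕ, (G ^ k) a ∈ p := fun k => by
    induction k with
    | zero => simpa using ha
    | succ k ih => rw [pow_succ', Module.End.mul_apply]; exact hp _ ih
  let b : ℕ → V := fun r => ∑ k ∈ Finset.range T, ((ζ ^ r)⁻¹ ^ k) • (G ^ k) a
  have hb : ∀ r : ℕ, b r ∈ p ⊓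
      G.eigenspace (Complex.exp (2 * Real.pi * Complex.I * (r : ℤ) / T)) := by
    intro r
    refine ⟨Submodule.sum_mem _ fun k _ => p.smul_mem _ (hpow k), ?_⟩
    have hz0 : ζ ^ r ≠ 0 := pow_ne_zero _ hζ0
    rw [hexp, zpow_natCast, SetLike.mem_coe, Module.End.mem_eigenspace_iff, map_sum]
    -- The summands at k = 0 and k = T agree, so the sum may be taken over 1, …, T instead; in this
    -- form applying G is a shift of index.
    have key := (Finset.sum_range_succ' (fun k => ((ζ ^ r)⁻¹ ^ k) • (G ^ k) a) T).symm.trans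
      (Finset.sum_range_succ (fun k => ((ζ ^ r)⁻¹ ^ k) • (G ^ k) a) T)
    have hzT : (ζ ^ r)⁻¹ ^ T = 1 := by
      rw [inv_pow, ← pow_mul, mul_comm, pow_mul, hprim.pow_eq_one, one_pow, inv_one]
    rw [hzT, hG] at key
    simp only [pow_zero, add_left_inj] at key
    rw [show b r = _ from key.symm, Finset.smul_sum]
    refine Finset.sum_congr rfl fun k _ => ?_
    rw [map_smul, smul_smul, pow_succ', ← mul_assoc, mul_inv_cancel₀ hz0, one_mul, pow_succ' G,
      Module.End.mul_apply]
  have hsum : ∑ r ∈ Finset.range T, b r = (T : ℂ) • a := by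
    simp only [b]
    rw [Finset.sum_comm, Finset.sum_eq_single 0]
    · simp [Nat.cast_smul_eq_nsmul]
    · intro k hk hk0
      rw [← Finset.sum_smul]
      have hk1 : (ζ ^ k)⁻¹ ≠ 1 := by
        rw [Ne, inv_eq_one]
        exact hprim.pow_ne_one_of_pos_of_lt hk0 (Finset.mem_range.1 hk)
      have : ∑ r ∈ Finset.range T, (ζ ^ r)⁻¹ ^ k = ∑ r ∈ Finset.range T, ((ζ ^ k)⁻¹) ^ r :=
        Finset.sum_congr rfl fun r _ => by rw [inv_pow, inv_pow, ← pow_mul, ← pow_mul, mul_comm]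
      rw [this, geom_sum_eq hk1, inv_pow, ← pow_mul, mul_comm k, pow_mul, hprim.pow_eq_one]
      simp
    · intro h
      exact absurd (Finset.mem_range.2 hT) h
  have hT0 : (T : ℂ) ≠ 0 := by exact_mod_cast hT.ne'
  have : a = (T : ℂ)⁻¹ • ∑ r ∈ Finset.range T, b r := by
    rw [hsum, smul_smul, inv_mul_cancel₀ hT0, one_smul]
  rw [this]
  exact Submodule.smul_mem _ _ (Submodule.sum_mem _ fun r _ =>
    Submodule.mem_iSup_of_mem (r : ℤ) (hb r))

namespace VertexOperatorAlgebra

variable {V : Type u} [AddCommGroup V] [Module ℂ V] (S : VertexOperatorAlgebra V)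
  {g : V ≃ₗ[ℂ] V}

theorem IsAutomorphism.map_mem_weightSpace {S : VertexOperatorAlgebra V} (hg : S.IsAutomorphism g)
    {a : V} {h : ℤ} (ha : a ∈ S.weightSpace h) : g a ∈ S.weightSpace h := by
  rw [mem_weightSpace] at *
  have := hg.map_mode S.conformal a 1
  rw [hg.map_conformal] at this
  rw [← this, ha, map_smul]

theorem weightSpace_le_iSup_inf_gEigenspace (hg : S.IsAutomorphism g) (hfin : IsOfFinOrder g)
    (h : ℤ) : S.weightSpace h ≤ ⨆ r : ℤ, S.weightSpace h ⊓ gEigenspace g r := by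
  intro a ha
  refine Module.End.mem_iSup_eigenspace_of_pow_eq_one hfin.orderOf_pos ?_
    (fun a ha => hg.map_mem_weightSpace ha) ha
  have : ∀ k : ℕ, (g : Module.End ℂ V) ^ k = ((g ^ k : V ≃ₗ[ℂ] V) : Module.End ℂ V) := fun k => by
    induction k with
    | zero => rfl
    | succ k ih => rw [pow_succ, ih, pow_succ]; rfl
  rw [this, pow_orderOf_eq_one]
  rfl

theorem isInternal_weightSpace : DirectSum.IsInternal S.weightSpace := S.grading

theorem iSup_weightSpace_eq_top : ⨆ h, S.weightSpace h = ⊤ :=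
  S.isInternal_weightSpace.submodule_iSup_eq_top

theorem mode_mem_gEigenspace {S : VertexOperatorAlgebra V} (hg : S.IsAutomorphism g) {a b : V}
    {r t : ℤ} (ha : a ∈ gEigenspace g r) (hb : b ∈ gEigenspace g t) (n : ℤ) :
    S.Y a n b ∈ gEigenspace g (r + t) := by
  rw [gEigenspace, Module.End.mem_eigenspace_iff] at *
  rw [LinearEquiv.coe_coe] at *
  rw [hg.map_mode, ha, hb]
  simp only [map_smul, Pi.smul_apply, LinearMap.smul_apply, smul_smul]
  rw [← Complex.exp_add]
  congr 2
  push_cast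
  ring

theorem vacuum_mem_gEigenspace {S : VertexOperatorAlgebra V} (hg : S.IsAutomorphism g) :
    S.vacuum ∈ gEigenspace g 0 := by
  rw [gEigenspace, Module.End.mem_eigenspace_iff]
  simp [hg.map_vacuum]

theorem conformal_mem_gEigenspace {S : VertexOperatorAlgebra V} (hg : S.IsAutomorphism g) :
    S.conformal ∈ gEigenspace g 0 := by
  rw [gEigenspace, Module.End.mem_eigenspace_iff]
  simp [hg.map_conformal]

variable (g) in
/-- The span of the `a_(-2) b` of weight `h` with `a`, `b` homogeneous and `a` an eigenvector of
`g`. -/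
def homogeneousC2 (h : ℤ) : Submodule ℂ V :=
  Submodule.span ℂ {x | ∃ (k l r : ℤ) (a b : V), k + l + 1 = h ∧ a ∈ S.weightSpace k ∧
    a ∈ gEigenspace g r ∧ b ∈ S.weightSpace l ∧ x = S.Y a (-2) b}

/-- The projection to the weight space `V_h`. -/
noncomputable def weightProj (h : ℤ) : V →ₗ[ℂ] V :=
  (S.weightSpace h).subtype ∘ₗ DirectSum.component ℂ ℤ (fun n => S.weightSpace n) h ∘ₗ
    (LinearEquiv.ofBijective (DirectSum.coeLinearMap S.weightSpace)
      S.isInternal_weightSpace).symm.toLinearMap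

theorem weightProj_of_mem {h k : ℤ} {a : V} (ha : a ∈ S.weightSpace k) :
    S.weightProj h a = if k = h then a else 0 := by
  have : (LinearEquiv.ofBijective (DirectSum.coeLinearMap S.weightSpace)
      S.isInternal_weightSpace).symm a =
      DirectSum.lof ℂ ℤ (fun n => S.weightSpace n) k ⟨a, ha⟩ := by
    rw [LinearEquiv.symm_apply_eq]
    exact (DirectSum.coeLinearMap_lof S.weightSpace k ⟨a, ha⟩).symm
  simp only [weightProj, LinearMap.comp_apply, LinearEquiv.coe_coe, this]
  split_ifs with hk
  · subst hk
    simp [DirectSum.component.lof_self]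
  · simp [DirectSum.component.of, hk]

/-- C_2(V) is a graded subspace: by bilinearity a and b may be taken homogeneous, and then a_(-2)b
is homogeneous. -/
theorem weightProj_mem_homogeneousC2 (hg : S.IsAutomorphism g) (hfin : IsOfFinOrder g) (h : ℤ)
    {x : V} (hx : x ∈ S.C2) : S.weightProj h x ∈ S.homogeneousC2 g h := by
  suffices ∀ a b : V, S.weightProj h (S.Y a (-2) b) ∈ S.homogeneousC2 g h by
    refine (Submodule.span_le (p := (S.homogeneousC2 g h).comap (S.weightProj h))).2 ?_ hx
    rintro _ ⟨a, b, rfl⟩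
    exact this a b
  intro a b
  have hb : b ∈ ⨆ l, S.weightSpace l := S.iSup_weightSpace_eq_top ▸ Submodule.mem_top
  have ha : a ∈ ⨆ k, S.weightSpace k := S.iSup_weightSpace_eq_top ▸ Submodule.mem_top
  refine (iSup_le fun l b hb => ?_ : _ ≤ (S.homogeneousC2 g h).comap
    (S.weightProj h ∘ₗ S.Y a (-2))) hb
  refine (iSup_le fun k => (S.weightSpace_le_iSup_inf_gEigenspace hg hfin k).trans
    (iSup_le fun r => ?_) : _ ≤ (S.homogeneousC2 g h).comap
    (S.weightProj h ∘ₗ LinearMap.applyₗ b ∘ₗ LinearMap.proj (-2) ∘ₗ S.Y)) ha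
  rintro a ⟨ha, har⟩
  simp only [Submodule.mem_comap, LinearMap.comp_apply, LinearMap.proj_apply,
    LinearMap.applyₗ_apply_apply]
  rw [S.weightProj_of_mem (S.mode_mem_weightSpace ha hb (-2))]
  split_ifs with e
  · exact Submodule.subset_span ⟨k, l, r, a, b, by omega, ha, har, hb, rfl⟩
  · exact Submodule.zero_mem _

/-- Homogeneous g-eigenvectors span V, so finitely many of them span V/C_2(V); projecting V = span +
C_2(V) to weight h gives the inclusion. Weight 0 is left out because V_0 is spanned by the vacuum,
whose modes are trivial. Positive generator weights later bound the length of a product by its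
weight. -/
theorem exists_finite_generators (hg : S.IsAutomorphism g) (hfin : IsOfFinOrder g)
    (hCFT : S.IsCFTType) (hC2 : S.IsC2Cofinite) :
    ∃ X : Set (ℤ × V), X.Finite ∧
      (∀ e ∈ X, 1 ≤ e.1 ∧ e.2 ∈ S.weightSpace e.1 ∧ ∃ r, e.2 ∈ gEigenspace g r) ∧
      ∀ h : ℤ, h ≠ 0 →
        S.weightSpace h ≤ Submodule.span ℂ {x | (h, x) ∈ X} ⊔ S.homogeneousC2 g h := by
  let H : Set (ℤ × V) := {e | e.2 ∈ S.weightSpace e.1 ∧ ∃ r, e.2 ∈ gEigenspace g r}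
  let f : ℤ × V → V ⧸ S.C2 := fun e => S.C2.mkQ e.2
  have hH : Submodule.span ℂ (f '' H) = ⊤ := by
    have h1 : (⊤ : Submodule ℂ V) ≤ (Submodule.span ℂ (f '' H)).comap S.C2.mkQ := by
      rw [← S.iSup_weightSpace_eq_top]
      refine iSup_le fun h => (S.weightSpace_le_iSup_inf_gEigenspace hg hfin h).trans
        (iSup_le fun r => ?_)
      rintro a ⟨ha, har⟩
      exact Submodule.subset_span ⟨(h, a), ⟨ha, r, har⟩, rfl⟩
    rw [eq_top_iff]
    rintro x -
    obtain ⟨a, rfl⟩ := S.C2.mkQ_surjective x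
    exact h1 Submodule.mem_top
  have hfg : (Submodule.span ℂ (f '' H)).FG := by
    rw [hH]
    have : FiniteDimensional ℂ (V ⧸ S.C2) := hC2
    exact Module.Finite.fg_top
  obtain ⟨t, ht, hspan⟩ := Submodule.fg_span_iff_fg_span_finset_subset _ |>.1 hfg
  classical
  obtain ⟨X, hXH, rfl⟩ := Finset.subset_set_image_iff.1 ht
  refine ⟨{e | e ∈ X ∧ 1 ≤ e.1}, X.finite_toSet.subset fun e he => he.1,
    fun e he => ⟨he.2, hXH he.1⟩, fun h h0 v hv => ?_⟩
  rcases lt_or_gt_of_ne h0 with h0 | h0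
  · rw [hCFT.1 h h0, Submodule.mem_bot] at hv
    rw [hv]
    exact Submodule.zero_mem _
  have hle : (⊤ : Submodule ℂ V) ≤ Submodule.span ℂ (Prod.snd '' (X : Set (ℤ × V))) ⊔ S.C2 := by
    rintro a -
    have : S.C2.mkQ a ∈ Submodule.map S.C2.mkQ
        (Submodule.span ℂ (Prod.snd '' (X : Set (ℤ × V)))) := by
      rw [Submodule.map_span, ← Set.image_comp]
      have e : (S.C2.mkQ ∘ Prod.snd) '' (X : Set (ℤ × V)) = ↑(X.image f) := by
        rw [Finset.coe_image]; rfl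
      rw [e, ← hspan, hH]
      exact Submodule.mem_top
    obtain ⟨y, hy, hya⟩ := this
    rw [← sub_eq_zero, ← map_sub, Submodule.mkQ_apply, Submodule.Quotient.mk_eq_zero] at hya
    have : a = y - (y - a) := by abel
    rw [this]
    exact Submodule.sub_mem _ (Submodule.mem_sup_left hy) (Submodule.mem_sup_right hya)
  have hle' : Submodule.span ℂ (Prod.snd '' (X : Set (ℤ × V))) ⊔ S.C2 ≤
      (Submodule.span ℂ {x | (h, x) ∈ {e | e ∈ X ∧ 1 ≤ e.1}} ⊔ S.homogeneousC2 g h).comap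
        (S.weightProj h) := by
    refine sup_le (Submodule.span_le.2 ?_) fun c hc =>
      Submodule.mem_sup_right (S.weightProj_mem_homogeneousC2 hg hfin h hc)
    rintro _ ⟨⟨k, x⟩, hx, rfl⟩
    rw [SetLike.mem_coe, Submodule.mem_comap, S.weightProj_of_mem (hXH hx).1]
    split_ifs with e
    · subst e
      exact Submodule.mem_sup_left (Submodule.subset_span ⟨hx, by show (1 : ℤ) ≤ k; omega⟩)
    · exact Submodule.zero_mem _
  have := hle' (hle (Submodule.mem_top (x := v)))
  rwa [Submodule.mem_comap, S.weightProj_of_mem hv, if_pos rfl] at this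

end VertexOperatorAlgebra

/-! ### Consequences of the twisted Jacobi identity -/

namespace WeakTwistedModule

variable {V : Type u} [AddCommGroup V] [Module ℂ V] {S : VertexOperatorAlgebra V} {g : V ≃ₗ[ℂ] V}
  {W : Type v} [AddCommGroup W] [Module ℂ W] (M : WeakTwistedModule S g W)

theorem mode_eq_zero_or {r : ℤ} {a : V} (ha : a ∈ gEigenspace g r) (q : ℚ) :
    M.Y a q = 0 ∨ ∃ k : ℤ, q = (r : ℚ) / orderOf g + k := by
  by_cases h : ∃ k : ℤ, q = (r : ℚ) / orderOf g + k
  · exact Or.inr h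
  · exact Or.inl (M.mode_support r a ha q fun k hk => h ⟨k, hk⟩)

theorem exists_nat_truncation (a : V) (w : W) (q : ℚ) :
    ∃ n : ℕ, ∀ j : ℕ, n ≤ j → M.Y a (q + j) w = 0 := by
  obtain ⟨N, hN⟩ := M.truncation a w
  obtain ⟨n, hn⟩ := exists_nat_ge (N - q)
  refine ⟨n, fun j hj => hN _ ?_⟩
  have : (n : ℚ) ≤ j := by exact_mod_cast hj
  linarith

theorem _root_.VertexOperatorAlgebra.exists_nat_truncation (S : VertexOperatorAlgebra V)
    (a b : V) (q : ℤ) : ∃ n : ℕ, ∀ j : ℕ, n ≤ j → S.Y a (q + j) b = 0 := by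
  obtain ⟨N, hN⟩ := S.truncation a b
  exact ⟨(N - q).toNat, fun j hj => hN _ (by omega)⟩

theorem commutator_mem {r : ℤ} {a : V} (ha : a ∈ gEigenspace g r) (b : V) (m n : ℚ) (w : W)
    (D : Submodule ℂ W) (hD : ∀ j : ℕ, M.Y (S.Y a j b) (m + n - j) w ∈ D) :
    M.Y a m (M.Y b n w) - M.Y b n (M.Y a m w) ∈ D := by
  rcases M.mode_eq_zero_or ha m with h0 | ⟨k, hk⟩
  · simp [h0]
  have h := M.jacobi r a ha b w k 0 m n hk
  rw [finsum_nat_eq_zero (by simp [Ring.choose_zero_succ]),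
    finsum_nat_eq_zero (by simp [Ring.choose_zero_succ])] at h
  simp only [Ring.choose_zero_right, pow_zero, Int.cast_one, mul_one, one_smul, Nat.cast_zero,
    sub_zero, add_zero, zpow_zero, Int.cast_zero, zero_add] at h
  rw [h]
  exact D.finsum_mem_of_forall fun j => D.smul_mem _ (hD j)

/-- The straightening relation: a product of two modes is traded for single modes and for products
with the same index sum but other indices. It is used when m and n are less than 1 apart, where both
families of new pairs are spread further. -/
theorem normalOrder_mem {r : ℤ} {a : V} (ha : a ∈ gEigenspace g r) (b : V) (m n : ℚ) (w : W)
    (D : Submodule ℂ W) (h0 : M.Y (S.Y a (-1) b) (m + n + 1) w ∈ D)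
    (h1 : ∀ j : ℕ, M.Y (S.Y a j b) (m + n - j) w ∈ D)
    (h2 : ∀ j : ℕ, M.Y a (m - (j + 1)) (M.Y b (n + (j + 1)) w) ∈ D)
    (h3 : ∀ j : ℕ, M.Y b (n - 1 - j) (M.Y a (m + 1 + j) w) ∈ D) :
    M.Y a m (M.Y b n w) ∈ D := by
  rcases M.mode_eq_zero_or ha m with h0 | ⟨k, hk⟩
  · simp [h0]
  -- With p = -1, raising the first index to m + 1 makes the j = 0 term of the first sum the product
  -- to be rewritten.
  have h := M.jacobi r a ha b w (k + 1) (-1) (m + 1) n (by rw [hk]; push_cast; ring)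
  obtain ⟨N, hN⟩ := M.exists_nat_truncation b w n
  rw [finsum_nat_eq_zero_add (n := N) (fun j hj => by rw [hN j hj]; simp), sub_eq_iff_eq_add,
    ← eq_sub_iff_add_eq] at h
  simp only [pow_zero, Ring.choose_zero_right, Int.cast_one, mul_one, one_smul, Nat.cast_zero,
    sub_zero, add_zero, Int.cast_neg, add_neg_cancel_right] at h
  rw [h]
  refine D.sub_mem (D.add_mem (D.finsum_mem_of_forall fun j => D.smul_mem _ ?_)
    (D.finsum_mem_of_forall fun j => D.smul_mem _ ?_))
    (D.finsum_mem_of_forall fun j => D.smul_mem _ ?_)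
  · cases j with
    | zero => convert h0 using 3; simp; ring
    | succ j => convert h1 j using 3 <;> push_cast <;> ring_nf
  · convert h3 j using 3; ring
  · convert h2 j using 3
    · push_cast; ring
    · push_cast; ring_nf

/-- Solves the Jacobi identity with p = -2 for the leading term on its right-hand side. What remains
has total weight at most wt a + wt b, one less than the weight of a_(-2)b, so elements of C_2(V) are
negligible in an induction on weight. -/
theorem mode_neg_two_mem {r : ℤ} {a : V} (ha : a ∈ gEigenspace g r) (b : V) (q : ℚ) (w : W)
    (D : Submodule ℂ W) (h1 : ∀ j : ℕ, M.Y (S.Y a (j - 1) b) (q - 1 - j) w ∈ D)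
    (h2 : ∀ m n : ℚ, m + n = q - 2 → M.Y a m (M.Y b n w) ∈ D)
    (h3 : ∀ m n : ℚ, m + n = q - 2 → M.Y b n (M.Y a m w) ∈ D) :
    M.Y (S.Y a (-2) b) q w ∈ D := by
  have h := (M.jacobi r a ha b w 0 (-2) (r / orderOf g) (q - r / orderOf g) (by simp)).symm
  obtain ⟨N, hN⟩ := S.exists_nat_truncation a b (-2)
  rw [finsum_nat_eq_zero_add (n := N) (fun j hj => by rw [hN j hj]; simp),
    ← eq_sub_iff_add_eq] at h
  simp only [Ring.choose_zero_right, Rat.cast_one, one_smul, Nat.cast_zero,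
    sub_zero, add_zero, add_sub_cancel] at h
  rw [h]
  refine D.sub_mem (D.sub_mem (D.finsum_mem_of_forall fun j => D.smul_mem _ (h2 _ _ ?_))
    (D.finsum_mem_of_forall fun j => D.smul_mem _ (h3 _ _ ?_)))
    (D.finsum_mem_of_forall fun j => D.smul_mem _ ?_)
  · push_cast; ring
  · push_cast; ring
  · convert h1 j using 3 <;> push_cast <;> ring_nf

/-- The L(-1)-derivative property on W, which is not an axiom of twisted modules; here a_(-2)𝟏 =
L(-1)a. It is needed for the commutator of L(0) with modes. -/
theorem mode_neg_two_vacuum (hg : S.IsAutomorphism g) (hfin : IsOfFinOrder g) (a : V) (q : ℚ) :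
    M.Y (S.Y a (-2) S.vacuum) q = (-q : ℂ) • M.Y a (q - 1) := by
  have ha : a ∈ ⨆ h, S.weightSpace h := S.iSup_weightSpace_eq_top ▸ Submodule.mem_top
  let f : V →ₗ[ℂ] Module.End ℂ W := LinearMap.proj q ∘ₗ M.Y ∘ₗ
    (LinearMap.applyₗ S.vacuum ∘ₗ LinearMap.proj (-2) ∘ₗ S.Y) +
      (q : ℂ) • (LinearMap.proj (q - 1) ∘ₗ M.Y)
  suffices ha : a ∈ LinearMap.ker f by
    have h := LinearMap.mem_ker.1 ha
    simp only [f, LinearMap.add_apply, LinearMap.comp_apply, LinearMap.proj_apply,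
      LinearMap.applyₗ_apply_apply, LinearMap.smul_apply] at h
    rw [neg_smul]
    exact eq_neg_of_add_eq_zero_left h
  refine (iSup_le fun h => (S.weightSpace_le_iSup_inf_gEigenspace hg hfin h).trans
    (iSup_le fun r => ?_) : _ ≤ LinearMap.ker f) ha
  rintro a ⟨-, ha⟩
  simp only [f, LinearMap.mem_ker, LinearMap.add_apply, LinearMap.comp_apply, LinearMap.proj_apply,
      LinearMap.applyₗ_apply_apply, LinearMap.smul_apply]
  have ha2 := S.mode_mem_gEigenspace hg ha (S.vacuum_mem_gEigenspace hg) (-2)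
  rw [add_zero] at ha2
  by_cases hq : ∃ k : ℤ, q = (r : ℚ) / orderOf g + k
  swap
  · rw [M.mode_support r _ ha2 q fun k hk => hq ⟨k, hk⟩, M.mode_support r a ha (q - 1) fun k hk =>
      hq ⟨k + 1, by push_cast; linarith⟩]
    simp
  obtain ⟨k, hk⟩ := hq
  ext w
  -- With p = -2 and n = 0 the vacuum modes that occur have index j or -2 - j, never -1, so the
  -- left-hand side vanishes.
  have h := M.jacobi r a ha S.vacuum w k (-2) q 0 hk
  rw [finsum_nat_eq_zero_add_one (f := fun j : ℕ => ((Ring.choose q j : ℚ) : ℂ) •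
    M.Y (S.Y a (-2 + j) S.vacuum) (q + 0 - j) w)] at h
  · simp only [Ring.choose_zero_right, Ring.choose_one_right, Rat.cast_one, one_smul,
      Nat.cast_zero, add_zero, sub_zero, Nat.cast_one] at h
    rw [show (-2 + 1 : ℤ) = -1 by norm_num, S.creation] at h
    simp only [LinearMap.add_apply, LinearMap.smul_apply, LinearMap.zero_apply]
    rw [← h]
    have e1 : ∀ j : ℕ, (j : ℚ) ≠ -1 := fun j hj => by
      linarith [(Nat.cast_nonneg j : (0 : ℚ) ≤ j)]
    have e2 : ∀ j : ℕ, (-2 : ℚ) - j ≠ -1 := fun j hj => by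
      linarith [(Nat.cast_nonneg j : (0 : ℚ) ≤ j)]
    simp [M.vacuum, e1, e2]
  · intro j
    have := S.creation_nonneg a j (by omega)
    rw [show (-2 + ((j + 2 : ℕ) : ℤ)) = j by push_cast; ring, this]
    simp

theorem commutator_conformal_one (hg : S.IsAutomorphism g) (hfin : IsOfFinOrder g) {a : V} {h : ℤ}
    (ha : a ∈ S.weightSpace h) (q : ℚ) (w : W) :
    M.Y S.conformal 1 (M.Y a q w) - M.Y a q (M.Y S.conformal 1 w) =
      ((h : ℂ) - q - 1) • M.Y a q w := by
  have e := M.jacobi 0 S.conformal (S.conformal_mem_gEigenspace hg) a w 1 0 1 q (by simp)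
  rw [finsum_nat_eq_zero (by simp [Ring.choose_zero_succ]),
    finsum_nat_eq_zero (by simp [Ring.choose_zero_succ]),
    finsum_nat_eq_zero_add_one (by simp [ringChoose_one_add_two])] at e
  simp only [Ring.choose_zero_right, Ring.choose_one_right] at e
  simp only [pow_zero, Int.cast_one, mul_one, one_smul, Nat.cast_zero, sub_zero, Int.cast_zero,
    add_zero, zpow_zero, Nat.cast_one, zero_add, add_sub_cancel_left, Rat.cast_one] at e
  rw [e, S.conformal_zero_eq, M.mode_neg_two_vacuum hg hfin, S.mem_weightSpace.1 ha]
  simp only [map_smul, Pi.smul_apply, LinearMap.smul_apply, add_sub_cancel_left]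
  push_cast
  module

end WeakTwistedModule

/-! ### Weight and degree of a product of modes -/

section ModeLists

variable {V : Type u}

/-- The sum of the weights of a list of modes `(h, a, q)`, where `h` is the weight of `a`. -/
def listWeight (L : List (ℤ × V × ℚ)) : ℤ := (L.map fun e => e.1).sum

/-- The sum of the degrees `h - q - 1` of a list of modes `(h, a, q)`. -/
def listDegree (L : List (ℤ × V × ℚ)) : ℚ := (L.map fun e => (e.1 : ℚ) - e.2.2 - 1).sum

@[simp] theorem listWeight_nil : listWeight ([] : List (ℤ × V × ℚ)) = 0 := rfl

@[simp] theorem listWeight_cons (e : ℤ × V × ℚ) (L : List (ℤ × V × ℚ)) :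
    listWeight (e :: L) = e.1 + listWeight L := by simp [listWeight]

@[simp] theorem listWeight_append (L K : List (ℤ × V × ℚ)) :
    listWeight (L ++ K) = listWeight L + listWeight K := by simp [listWeight]

@[simp] theorem listDegree_nil : listDegree ([] : List (ℤ × V × ℚ)) = 0 := rfl

@[simp] theorem listDegree_cons (e : ℤ × V × ℚ) (L : List (ℤ × V × ℚ)) :
    listDegree (e :: L) = (e.1 - e.2.2 - 1) + listDegree L := by simp [listDegree]

@[simp] theorem listDegree_append (L K : List (ℤ × V × ℚ)) :
    listDegree (L ++ K) = listDegree L + listDegree K := by simp [listDegree]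

theorem List.Perm.listWeight_eq {L K : List (ℤ × V × ℚ)} (h : L.Perm K) :
    listWeight L = listWeight K := (h.map _).sum_eq

theorem List.Perm.listDegree_eq {L K : List (ℤ × V × ℚ)} (h : L.Perm K) :
    listDegree L = listDegree K := (h.map _).sum_eq

end ModeLists

variable {V : Type u} [AddCommGroup V] [Module ℂ V] {S : VertexOperatorAlgebra V} {g : V ≃ₗ[ℂ] V}
  {W : Type v} [AddCommGroup W] [Module ℂ W]

namespace VertexOperatorAlgebra

/-- In every entry `(h, a, q)` of the list, `a` has weight `h`. -/
def IsHomogeneousList (S : VertexOperatorAlgebra V) (L : List (ℤ × V × ℚ)) : Prop :=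
  ∀ e ∈ L, e.2.1 ∈ S.weightSpace e.1

@[simp] theorem isHomogeneousList_nil : S.IsHomogeneousList [] := by
  simp [IsHomogeneousList]

@[simp] theorem isHomogeneousList_cons {e : ℤ × V × ℚ} {L : List (ℤ × V × ℚ)} :
    S.IsHomogeneousList (e :: L) ↔ e.2.1 ∈ S.weightSpace e.1 ∧ S.IsHomogeneousList L := by
  simp [IsHomogeneousList]

@[simp] theorem isHomogeneousList_append {L K : List (ℤ × V × ℚ)} :
    S.IsHomogeneousList (L ++ K) ↔ S.IsHomogeneousList L ∧ S.IsHomogeneousList K := by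
  simp [IsHomogeneousList, or_imp, forall_and]

end VertexOperatorAlgebra

/-! ### Rewriting products modulo products of smaller total weight -/

namespace WeakTwistedModule

variable (M : WeakTwistedModule S g W)

/-- The product of the modes `a_(q)` over the entries `(h, a, q)` of a list. -/
def monomial (L : List (ℤ × V × ℚ)) : Module.End ℂ W := (L.map fun e => M.Y e.2.1 e.2.2).prod

@[simp] theorem monomial_nil : M.monomial [] = 1 := rfl

@[simp] theorem monomial_cons (e : ℤ × V × ℚ) (L : List (ℤ × V × ℚ)) :
    M.monomial (e :: L) = M.Y e.2.1 e.2.2 * M.monomial L := by simp [monomial]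

@[simp] theorem monomial_append (L K : List (ℤ × V × ℚ)) :
    M.monomial (L ++ K) = M.monomial L * M.monomial K := by simp [monomial]

/-- The monomials of weight less than `n`, applied to `w`, lie in the subspaces `D d`, where `d` is
the degree. -/
def MonomialsBelow (w : W) (D : ℚ → Submodule ℂ W) (n : ℤ) : Prop :=
  ∀ L, S.IsHomogeneousList L → listWeight L < n → M.monomial L w ∈ D (listDegree L)

variable {M} {w : W} {D : ℚ → Submodule ℂ W} {n : ℤ}

theorem MonomialsBelow.insert_mem (hn : M.MonomialsBelow w D n) {P R : List (ℤ × V × ℚ)}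
    (hP : S.IsHomogeneousList P) (hR : S.IsHomogeneousList R) {c : V} {h : ℤ}
    (hc : c ∈ S.weightSpace h) {q d : ℚ} (hwt : listWeight P + h + listWeight R < n)
    (hd : listDegree P + (h - q - 1) + listDegree R = d) :
    M.Y c q (M.monomial R w) ∈ (D d).comap (M.monomial P) := by
  have := hn (P ++ (h, c, q) :: R) (by simp [hP, hR, hc]) (by simpa [← add_assoc] using hwt)
  rw [← hd]
  simpa [← add_assoc] using this

theorem MonomialsBelow.insert_pair_mem (hn : M.MonomialsBelow w D n) {P R : List (ℤ × V × ℚ)}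
    (hP : S.IsHomogeneousList P) (hR : S.IsHomogeneousList R) {a b : V} {h k : ℤ}
    (ha : a ∈ S.weightSpace h) (hb : b ∈ S.weightSpace k) {q t d : ℚ}
    (hwt : listWeight P + h + k + listWeight R < n)
    (hd : listDegree P + (h - q - 1) + (k - t - 1) + listDegree R = d) :
    M.Y a q (M.Y b t (M.monomial R w)) ∈ (D d).comap (M.monomial P) := by
  have := hn.insert_mem (R := (k, b, t) :: R) hP (by simp [hR, hb]) ha (q := q) (d := d)
    (by simp; omega) (by simp; linarith)
  simpa using this

/-- Modes commute modulo lower weight: the commutator involves only a_(j)b with j ≥ 0, of weight wt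
a + wt b - j - 1. -/
theorem MonomialsBelow.swap_mem (hn : M.MonomialsBelow w D n) {P R : List (ℤ × V × ℚ)}
    {e f : ℤ × V × ℚ} (hP : S.IsHomogeneousList P) (hR : S.IsHomogeneousList R)
    (he : e.2.1 ∈ S.weightSpace e.1) (hf : f.2.1 ∈ S.weightSpace f.1) {r : ℤ}
    (her : e.2.1 ∈ gEigenspace g r) (hwt : listWeight (P ++ e :: f :: R) ≤ n) :
    M.monomial (P ++ e :: f :: R) w - M.monomial (P ++ f :: e :: R) w ∈
      D (listDegree (P ++ e :: f :: R)) := by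
  have := M.commutator_mem her f.2.1 e.2.2 f.2.2 (M.monomial R w)
    ((D (listDegree (P ++ e :: f :: R))).comap (M.monomial P)) fun j =>
      hn.insert_mem hP hR (S.mode_mem_weightSpace he hf j) (by simp at hwt; omega)
        (by simp; ring)
  simpa using this

theorem MonomialsBelow.perm_mem (hn : M.MonomialsBelow w D n) {L K : List (ℤ × V × ℚ)}
    (hLK : L.Perm K) : ∀ P, S.IsHomogeneousList P → S.IsHomogeneousList L →
      (∀ e ∈ L, ∃ r, e.2.1 ∈ gEigenspace g r) → listWeight (P ++ L) ≤ n →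
      M.monomial (P ++ L) w - M.monomial (P ++ K) w ∈ D (listDegree (P ++ L)) := by
  induction hLK with
  | nil => intro P _ _ _ _; simp
  | cons e hLK ih =>
    rename_i L K
    intro P hP hL hg hwt
    have := ih (P ++ [e]) (by simp_all) (by simp_all) (fun x hx => hg x (by simp [hx]))
      (by simpa using hwt)
    simpa using this
  | swap e f L =>
    intro P hP hL hg hwt
    obtain ⟨r, hr⟩ := hg f (by simp)
    exact hn.swap_mem hP (by simp_all) (by simp_all) (by simp_all) hr hwt
  | trans h1 h2 ih1 ih2 =>
    rename_i L K J
    intro P hP hL hg hwt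
    have hw1 : listWeight (P ++ L) = listWeight (P ++ K) := (h1.append_left P).listWeight_eq
    have hd1 : listDegree (P ++ L) = listDegree (P ++ K) := (h1.append_left P).listDegree_eq
    have e1 := ih1 P hP hL hg hwt
    have e2 := ih2 P hP (fun x hx => hL x (h1.mem_iff.2 hx)) (fun x hx => hg x (h1.mem_iff.2 hx))
      (hw1 ▸ hwt)
    rw [← hd1] at e2
    simpa using add_mem e1 e2

theorem MonomialsBelow.mem_of_perm (hn : M.MonomialsBelow w D n) {L K : List (ℤ × V × ℚ)}
    (hLK : L.Perm K) (hL : S.IsHomogeneousList L) (hg : ∀ e ∈ L, ∃ r, e.2.1 ∈ gEigenspace g r)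
    (hwt : listWeight L ≤ n) (hK : M.monomial K w ∈ D (listDegree K)) :
    M.monomial L w ∈ D (listDegree L) := by
  have := hn.perm_mem hLK [] (by simp) hL hg hwt
  rw [List.nil_append, List.nil_append, hLK.listDegree_eq] at this
  rw [hLK.listDegree_eq]
  simpa using add_mem this hK

variable {X : Set (ℤ × V)}

/-- Entries are replaced by generators from left to right: P is the part already treated, R the
rest. By linearity in the first entry of R there are three cases: the vacuum gives zero or a shorter
product, a generator moves into P, and an element of C_2(V) gives products of lower weight. -/
theorem MonomialsBelow.mem_of_generators (hn : M.MonomialsBelow w D n) (hCFT : S.IsCFTType)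
    (hX : ∀ e ∈ X, 1 ≤ e.1 ∧ e.2 ∈ S.weightSpace e.1 ∧ ∃ r, e.2 ∈ gEigenspace g r)
    (hgen : ∀ h : ℤ, h ≠ 0 →
        S.weightSpace h ≤ Submodule.span ℂ {x | (h, x) ∈ X} ⊔ S.homogeneousC2 g h) {k : ℕ}
    (hk : ∀ L, S.IsHomogeneousList L → listWeight L ≤ n → L.length < k →
      M.monomial L w ∈ D (listDegree L))
    (hXk : ∀ L : List (ℤ × V × ℚ), (∀ e ∈ L, (e.1, e.2.1) ∈ X) → listWeight L ≤ n →
      L.length = k → M.monomial L w ∈ D (listDegree L)) :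
    ∀ R P : List (ℤ × V × ℚ), (∀ e ∈ P, (e.1, e.2.1) ∈ X) → S.IsHomogeneousList R →
      listWeight (P ++ R) ≤ n → (P ++ R).length = k →
      M.monomial (P ++ R) w ∈ D (listDegree (P ++ R)) := by
  intro R
  induction R with
  | nil =>
    intro P hP _ hwt hlen
    rw [List.append_nil] at *
    exact hXk P hP hwt hlen
  | cons e R ih =>
    intro P hP hR hwt hlen
    obtain ⟨h, a, q⟩ := e
    have hPh : S.IsHomogeneousList P := fun e he => (hX _ (hP e he)).2.1
    obtain ⟨ha, hR'⟩ := S.isHomogeneousList_cons.1 hR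
    simp only at ha
    let f : V →ₗ[ℂ] W := M.monomial P ∘ₗ LinearMap.applyₗ (M.monomial R w) ∘ₗ
      LinearMap.proj q ∘ₗ M.Y
    have hf : ∀ x, f x = M.monomial (P ++ (h, x, q) :: R) w := fun x => by simp [f]
    have hdeg : ∀ x, listDegree (P ++ (h, x, q) :: R) = listDegree (P ++ (h, a, q) :: R) :=
      fun x => by simp
    suffices S.weightSpace h ≤ (D (listDegree (P ++ (h, a, q) :: R))).comap f by
      have := this ha
      rwa [Submodule.mem_comap, hf] at this
    rcases eq_or_ne h 0 with rfl | h0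
    · rw [hCFT.2, Submodule.span_le, Set.singleton_subset_iff, SetLike.mem_coe,
        Submodule.mem_comap]
      simp only [f, LinearMap.comp_apply, LinearMap.proj_apply, LinearMap.applyₗ_apply_apply,
        M.vacuum]
      split_ifs with hq
      · have := hk (P ++ R) (by simp [hPh, hR']) (by simpa using hwt) (by simp at *; omega)
        simpa [hq] using this
      · simp
    · refine (hgen h h0).trans (sup_le (Submodule.span_le.2 fun x hx => ?_)
        (Submodule.span_le.2 ?_))
      · have := ih (P ++ [(h, x, q)])
          (by
            intro e he
            rcases List.mem_append.1 he with he | he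
            · exact hP e he
            · rw [List.mem_singleton.1 he]; exact hx) hR'
          (by simpa using hwt) (by simpa using hlen)
        rw [SetLike.mem_coe, Submodule.mem_comap, hf, ← hdeg x]
        simpa using this
      · rintro _ ⟨k, l, r, x, y, hkl, hx, hxr, hy, rfl⟩
        have hkl' : (k : ℚ) + l + 1 = h := by exact_mod_cast hkl
        refine M.mode_neg_two_mem hxr y q (M.monomial R w) ((D _).comap (M.monomial P)) ?_ ?_ ?_
        · intro j
          exact hn.insert_mem hPh hR' (S.mode_mem_weightSpace hx hy _) (by simp at hwt; omega)
            (by simp; linarith)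
        · intro m t hmt
          exact hn.insert_pair_mem hPh hR' hx hy (by simp at hwt; omega) (by simp; linarith)
        · intro m t hmt
          exact hn.insert_pair_mem hPh hR' hy hx (by simp at hwt; omega) (by simp; linarith)

end WeakTwistedModule

/-! ### Reduced lists and the measure of spread -/

section ModeLists

variable {V : Type u}

/-- A list of modes of the generators `X`, with indices in `(1/T)ℤ` that are less than `N` and
pairwise at distance at least `1`. -/
structure IsReducedList (X : Set (ℤ × V)) (T : ℕ) (N : ℚ) (L : List (ℤ × V × ℚ)) : Prop where
  mem : ∀ e ∈ L, (e.1, e.2.1) ∈ X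
  lt : ∀ e ∈ L, e.2.2 < N
  frac : ∀ e ∈ L, ∃ n : ℤ, e.2.2 = n / T
  separated : L.Pairwise fun e f => 1 ≤ |e.2.2 - f.2.2|

theorem List.sum_sq_le_sq_sum {L : List ℚ} (hL : ∀ x ∈ L, 0 ≤ x) :
    0 ≤ L.sum ∧ (L.map fun x => x ^ 2).sum ≤ L.sum ^ 2 := by
  induction L with
  | nil => simp
  | cons x L ih =>
    obtain ⟨h1, h2⟩ := ih fun y hy => hL y (by simp [hy])
    have h3 := hL x (by simp)
    simp only [List.map_cons, List.sum_cons]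
    exact ⟨by positivity, by nlinarith [mul_nonneg h1 h3]⟩

/-- The total distance of the indices to `N`. -/
def listDeficit (N : ℚ) (L : List (ℤ × V × ℚ)) : ℚ := (L.map fun e => N - e.2.2).sum

/-- The sum of the squared distances of the indices to `N`. -/
def listSqDeficit (N : ℚ) (L : List (ℤ × V × ℚ)) : ℚ := (L.map fun e => (N - e.2.2) ^ 2).sum

@[simp] theorem listDeficit_cons (N : ℚ) (e : ℤ × V × ℚ) (L : List (ℤ × V × ℚ)) :
    listDeficit N (e :: L) = (N - e.2.2) + listDeficit N L := by simp [listDeficit]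

@[simp] theorem listSqDeficit_cons (N : ℚ) (e : ℤ × V × ℚ) (L : List (ℤ × V × ℚ)) :
    listSqDeficit N (e :: L) = (N - e.2.2) ^ 2 + listSqDeficit N L := by simp [listSqDeficit]

theorem listSqDeficit_le {N : ℚ} {L : List (ℤ × V × ℚ)} (hL : ∀ e ∈ L, e.2.2 < N) :
    listSqDeficit N L ≤ listDeficit N L ^ 2 := by
  have := (List.sum_sq_le_sq_sum (L := L.map fun e => N - e.2.2) (by
    intro x hx
    obtain ⟨e, he, rfl⟩ := List.mem_map.1 hx
    linarith [hL e he])).2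
  simpa [listSqDeficit, listDeficit, Function.comp_def] using this

/-- The right-hand side is the increase of the sum of squared deficits when two indices at signed
distance δ are moved apart by j + 1 each. Integrality of T(j + 1 - δ) bounds this below
independently of j, so straightening terminates. -/
theorem two_div_le_of_abs_lt_one {T : ℕ} (hT : 0 < T) {i : ℤ} {δ : ℚ} (hδ : δ = i / T)
    (h1 : |δ| < 1) (j : ℕ) : 2 / T ≤ 2 * ((j : ℚ) + 1) * (j + 1 - δ) := by
  have hT' : (0 : ℚ) < T := by exact_mod_cast hT
  have hj : (0 : ℚ) ≤ j := by positivity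
  have hlt := (abs_lt.1 h1).2
  have h2 : 1 ≤ T * ((j : ℚ) + 1 - δ) := by
    have e : (T : ℚ) * ((j : ℚ) + 1 - δ) = ((T * (j + 1) - i : ℤ) : ℚ) := by
      rw [hδ]
      push_cast
      field_simp
    have hpos : (0 : ℚ) < T * ((j : ℚ) + 1 - δ) := mul_pos hT' (by linarith)
    rw [e] at hpos ⊢
    exact_mod_cast hpos
  rw [div_le_iff₀ hT']
  nlinarith

end ModeLists

/-! ### Straightening to reduced products -/

namespace WeakTwistedModule

/-- The span of the reduced monomials of degree `d`, applied to `w`. -/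
def reducedSpan (M : WeakTwistedModule S g W) (w : W) (X : Set (ℤ × V)) (N d : ℚ) :
    Submodule ℂ W :=
  Submodule.span ℂ {x | ∃ L, IsReducedList X (orderOf g) N L ∧ listDegree L = d ∧
    x = M.monomial L w}

variable {M : WeakTwistedModule S g W} {w : W} {n : ℤ} {X : Set (ℤ × V)} {N : ℚ}

theorem monomial_eq_zero {L : List (ℤ × V × ℚ)} {e : ℤ × V × ℚ} (he : e ∈ L)
    (h : M.Y e.2.1 e.2.2 = 0) : M.monomial L = 0 :=
  List.prod_eq_zero (List.mem_map.2 ⟨e, he, h⟩)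

/-- A mode that kills w can be moved to the right end modulo lower weight. -/
theorem MonomialsBelow.mem_of_annihilates {D : ℚ → Submodule ℂ W} (hn : M.MonomialsBelow w D n)
    {L : List (ℤ × V × ℚ)} (hL : S.IsHomogeneousList L)
    (hg : ∀ e ∈ L, ∃ r, e.2.1 ∈ gEigenspace g r) (hwt : listWeight L ≤ n) {e : ℤ × V × ℚ}
    (he : e ∈ L) (h : M.Y e.2.1 e.2.2 w = 0) : M.monomial L w ∈ D (listDegree L) := by
  obtain ⟨s, t, rfl⟩ := List.append_of_mem he
  refine hn.mem_of_perm (K := (s ++ t) ++ [e]) ?_ hL hg hwt (by simp [h])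
  rw [List.append_assoc]
  exact List.Perm.append_left s (List.perm_append_singleton e t).symm

/-- Straightening preserves the total deficit A and raises the sum of squared deficits by at least
2/|g|. While all indices stay below N that sum is at most A², and otherwise some mode kills w; so i
bounds the number of remaining steps. -/
theorem MonomialsBelow.generator_monomial_mem (hT : 0 < orderOf g)
    (hn : M.MonomialsBelow w (M.reducedSpan w X N) n)
    (hX : ∀ e ∈ X, 1 ≤ e.1 ∧ e.2 ∈ S.weightSpace e.1 ∧ ∃ r, e.2 ∈ gEigenspace g r)
    (hN : ∀ e ∈ X, ∀ q, N ≤ q → M.Y e.2 q w = 0) {k : ℕ}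
    (hk : ∀ L, S.IsHomogeneousList L → listWeight L ≤ n → L.length < k →
      M.monomial L w ∈ M.reducedSpan w X N (listDegree L)) (A : ℚ) (i : ℕ) :
    ∀ L : List (ℤ × V × ℚ), (∀ e ∈ L, (e.1, e.2.1) ∈ X) → listWeight L ≤ n →
      L.length = k → listDeficit N L = A → A ^ 2 - i * (2 / orderOf g) < listSqDeficit N L →
      M.monomial L w ∈ M.reducedSpan w X N (listDegree L) := by
  induction i with
  | zero =>
    intro L hL hwt _ hA hsq
    by_cases hlt : ∀ e ∈ L, e.2.2 < N
    · have := listSqDeficit_le hlt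
      rw [hA] at this
      simp at hsq
      linarith
    · push Not at hlt
      obtain ⟨e, he, hqe⟩ := hlt
      exact hn.mem_of_annihilates (fun e he => (hX _ (hL e he)).2.1)
        (fun e he => (hX _ (hL e he)).2.2) hwt he (hN _ (hL e he) _ hqe)
  | succ i ih =>
    intro L hL hwt hlen hA hsq
    have hLh : S.IsHomogeneousList L := fun e he => (hX _ (hL e he)).2.1
    have hLg : ∀ e ∈ L, ∃ r, e.2.1 ∈ gEigenspace g r := fun e he => (hX _ (hL e he)).2.2
    by_cases hlt : ∀ e ∈ L, e.2.2 < N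
    swap
    · push Not at hlt
      obtain ⟨e, he, hqe⟩ := hlt
      exact hn.mem_of_annihilates hLh hLg hwt he (hN _ (hL e he) _ hqe)
    by_cases hfrac : ∀ e ∈ L, ∃ n : ℤ, e.2.2 = n / orderOf g
    swap
    · push Not at hfrac
      obtain ⟨e, he, hqe⟩ := hfrac
      obtain ⟨r, hr⟩ := hLg e he
      have hT' : (orderOf g : ℚ) ≠ 0 := by exact_mod_cast hT.ne'
      rw [monomial_eq_zero he (M.mode_support r _ hr _ fun k hk => hqe (r + k * orderOf g) (by
        rw [hk]; push_cast; field_simp))]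
      simp
    by_cases hsep : L.Pairwise fun e f => 1 ≤ |e.2.2 - f.2.2|
    · exact Submodule.subset_span ⟨L, ⟨hL, hlt, hfrac, hsep⟩, rfl, rfl⟩
    rw [List.pairwise_iff_forall_sublist] at hsep
    push Not at hsep
    obtain ⟨e, f, hef, hdist⟩ := hsep
    obtain ⟨R, hR⟩ := hef.exists_perm_append
    -- The two modes that are too close are brought to the front; weight, degree and both deficits
    -- do not depend on the order.
    refine hn.mem_of_perm hR hLh hLg hwt ?_
    have hK : ∀ x ∈ [e, f] ++ R, (x.1, x.2.1) ∈ X := fun x hx => hL x (hR.mem_iff.2 hx)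
    have hKA : listDeficit N ([e, f] ++ R) = A := hA ▸ (hR.map _).sum_eq.symm
    have hKsq : listSqDeficit N ([e, f] ++ R) = listSqDeficit N L := (hR.map _).sum_eq.symm
    rw [hR.listWeight_eq] at hwt
    rw [hR.length_eq] at hlen
    obtain ⟨ne, hne⟩ := hfrac e (hR.mem_iff.2 (by simp))
    obtain ⟨nf, hnf⟩ := hfrac f (hR.mem_iff.2 (by simp))
    rw [← hKsq] at hsq
    clear hef hR hL hLh hLg hlt hfrac hKsq hA
    obtain ⟨h, a, m⟩ := e
    obtain ⟨l, b, t⟩ := f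
    have hRh : S.IsHomogeneousList R := fun e he => (hX _ (hK e (by simp [he]))).2.1
    have ha' : (h, a) ∈ X := hK (h, a, m) (by simp)
    have hb' : (l, b) ∈ X := hK (l, b, t) (by simp)
    obtain ⟨-, ha, r, hr⟩ := hX _ ha'
    obtain ⟨-, hb, -⟩ := hX _ hb'
    simp only at ha hb hr hne hnf hdist
    have hRX : ∀ x ∈ R, (x.1, x.2.1) ∈ X := fun x hx => hK x (by simp [hx])
    have hδ : m - t = ((ne - nf : ℤ) : ℚ) / orderOf g := by rw [hne, hnf]; push_cast; ring
    have hδ' : t - m = ((nf - ne : ℤ) : ℚ) / orderOf g := by rw [hne, hnf]; push_cast; ring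
    simp at hwt hlen hKA hsq
    have hcast : ∀ {x : W} {d : ℚ}, x ∈ M.reducedSpan w X N d →
        d = listDegree ([(h, a, m), (l, b, t)] ++ R) →
        x ∈ M.reducedSpan w X N (listDegree ([(h, a, m), (l, b, t)] ++ R)) := fun h e => e ▸ h
    have key : M.Y a m (M.Y b t (M.monomial R w)) ∈
        M.reducedSpan w X N (listDegree ([(h, a, m), (l, b, t)] ++ R)) := by
      refine M.normalOrder_mem hr b m t _ _ ?_ ?_ ?_ ?_
      -- The mode of a_(-1)b has the full weight wt a + wt b, so weight induction does not apply;
      -- the list is shorter by one instead.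
      · have := hcast (hk ((h + l, S.Y a (-1) b, m + t + 1) :: R)
          (by
            have := S.mode_mem_weightSpace ha hb (-1)
            simp [hRh]; convert this using 2; ring)
          (by simp; omega) (by simp; omega)) (by simp; ring)
        simpa using this
      · intro j
        have := hn.insert_mem (P := []) (by simp) hRh (S.mode_mem_weightSpace ha hb j)
          (q := m + t - j) (d := listDegree ([(h, a, m), (l, b, t)] ++ R)) (by simp; omega)
          (by simp; ring)
        simpa using this
      · intro j
        have hj := two_div_le_of_abs_lt_one hT hδ hdist j
        have := hcast (ih ((h, a, m - (j + 1)) :: (l, b, t + (j + 1)) :: R)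
          (by simpa using ⟨ha', hb', fun h a q he => hRX _ he⟩)
          (by simp; omega) (by simp; omega) (by simp; linarith) (by simp; nlinarith))
          (by simp; ring)
        simpa using this
      · intro j
        have hj := two_div_le_of_abs_lt_one hT hδ' (by rwa [abs_sub_comm]) j
        have := hcast (ih ((l, b, t - 1 - j) :: (h, a, m + 1 + j) :: R)
          (by simpa using ⟨hb', ha', fun h a q he => hRX _ he⟩)
          (by simp; omega) (by simp; omega) (by simp; linarith) (by simp; nlinarith))
          (by simp; ring)
        simpa using this
    simpa using key

/-- Three nested inductions: on total weight, then on length, then on the spread of the indices.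
Weight induction starts at 0 because a list of negative weight contains a vector of negative weight,
which is zero. -/
theorem monomial_mem_reducedSpan (hfin : IsOfFinOrder g) (hCFT : S.IsCFTType)
    (hX : ∀ e ∈ X, 1 ≤ e.1 ∧ e.2 ∈ S.weightSpace e.1 ∧ ∃ r, e.2 ∈ gEigenspace g r)
    (hgen : ∀ h : ℤ, h ≠ 0 →
        S.weightSpace h ≤ Submodule.span ℂ {x | (h, x) ∈ X} ⊔ S.homogeneousC2 g h)
    (hN : ∀ e ∈ X, ∀ q, N ≤ q → M.Y e.2 q w = 0) {L : List (ℤ × V × ℚ)}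
    (hL : S.IsHomogeneousList L) : M.monomial L w ∈ M.reducedSpan w X N (listDegree L) := by
  have main : ∀ n : ℕ, M.MonomialsBelow w (M.reducedSpan w X N) n := by
    intro n
    induction n with
    | zero =>
      intro L hL hwt
      have : ∃ e ∈ L, e.1 < 0 := by
        by_contra! hnonneg
        refine absurd hwt (not_lt.2 (List.sum_nonneg fun x hx => ?_))
        obtain ⟨e, he, rfl⟩ := List.mem_map.1 hx
        exact hnonneg e he
      obtain ⟨e, he, he0⟩ := this
      have h0 := hL e he
      rw [hCFT.1 _ he0, Submodule.mem_bot] at h0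
      rw [monomial_eq_zero he (by rw [h0, map_zero]; rfl)]
      simp
    | succ n ih =>
      have hlen : ∀ k : ℕ, ∀ L, S.IsHomogeneousList L → listWeight L ≤ n → L.length < k →
          M.monomial L w ∈ M.reducedSpan w X N (listDegree L) := by
        intro k
        induction k with
        | zero => intro L _ _ h; exact absurd h (Nat.not_lt_zero _)
        | succ k ihk =>
          intro L hL hwt hlen
          rcases Nat.lt_succ_iff_lt_or_eq.1 hlen with hlen | hlen
          · exact ihk L hL hwt hlen
          refine ih.mem_of_generators hCFT hX hgen ihk (fun K hK hKwt hKlen => ?_) L [] (by simp)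
            hL hwt hlen
          have hT : (0 : ℚ) < 2 / orderOf g := by
            have : (0 : ℚ) < orderOf g := by exact_mod_cast hfin.orderOf_pos
            positivity
          obtain ⟨i, hi⟩ := exists_nat_gt
            ((listDeficit N K ^ 2 - listSqDeficit N K) / (2 / orderOf g : ℚ))
          rw [div_lt_iff₀ hT] at hi
          exact ih.generator_monomial_mem hfin.orderOf_pos hX hN ihk _ i K hK hKwt hKlen rfl
            (by linarith)
      intro L hL hwt
      exact hlen _ L hL (by push_cast at hwt; omega) (Nat.lt_succ_self _)
  exact main ((listWeight L).toNat + 1) L hL (by omega)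

end WeakTwistedModule

/-! ### Counting reduced lists of given degree -/

section ModeLists

variable {V : Type u} {X : Set (ℤ × V)} {T : ℕ} {N : ℚ}

/-- Separated numbers have distinct floors, and k distinct natural numbers sum to at least 0 + 1 + ⋯
+ (k - 1). -/
theorem List.length_mul_le_sum_of_separated {L : List ℚ} (h0 : ∀ x ∈ L, 0 ≤ x)
    (hL : L.Pairwise fun x y => 1 ≤ |x - y|) :
    (L.length : ℚ) * (L.length - 1) / 2 ≤ L.sum := by
  have hnd : (L.map Int.floor).Nodup := by
    rw [List.Nodup, List.pairwise_map]
    exact hL.imp fun {x y} h e => absurd h (not_le.2 (Int.abs_sub_lt_one_of_floor_eq_floor e))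
  have h1 : ((L.map Int.floor).sum : ℚ) ≤ L.sum := by
    clear hL h0 hnd
    induction L with
    | nil => simp
    | cons x L ih =>
      simp only [List.map_cons, List.sum_cons, Int.cast_add]
      exact add_le_add (Int.floor_le x) ih
  have h2 := Finset.sum_range_le_sum (s := (L.map Int.floor).toFinset) (c := 0) (by
    intro x hx
    obtain ⟨y, hy, rfl⟩ := List.mem_map.1 (List.mem_toFinset.1 hx)
    exact Int.floor_nonneg.2 (h0 y hy))
  rw [List.toFinset_card_of_nodup hnd, List.length_map, List.sum_toFinset _ hnd] at h2
  simp only [zero_add, List.map_id'] at h2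
  have h3 : ∀ n : ℕ, (n : ℚ) * (n - 1) / 2 = ((∑ i ∈ Finset.range n, (i : ℤ) : ℤ) : ℚ) := by
    intro n
    induction n with
    | zero => simp
    | succ n ih =>
      rw [Finset.sum_range_succ, Int.cast_add, ← ih]
      push_cast
      ring
  rw [h3]
  refine le_trans ?_ h1
  exact_mod_cast h2

theorem listDeficit_eq (L : List (ℤ × V × ℚ)) :
    listDeficit N L = listDegree L - listWeight L + L.length * (N + 1) := by
  induction L with
  | nil => simp [listDeficit]
  | cons e L ih => simp [ih]; ring

namespace IsReducedList

variable {L : List (ℤ × V × ℚ)}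

theorem length_mul_le_deficit (h : IsReducedList X T N L) :
    (L.length : ℚ) * (L.length - 1) / 2 ≤ listDeficit N L := by
  have := List.length_mul_le_sum_of_separated (L := L.map fun e => N - e.2.2) (by
    intro x hx
    obtain ⟨e, he, rfl⟩ := List.mem_map.1 hx
    linarith [h.lt e he]) (by
    rw [List.pairwise_map]
    exact h.separated.imp fun {e f} hef => by
      rwa [sub_sub_sub_cancel_left, abs_sub_comm])
  simpa [listDeficit] using this

theorem length_le_weight (h : IsReducedList X T N L) (hX : ∀ e ∈ X, 1 ≤ e.1) :
    (L.length : ℤ) ≤ listWeight L := by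
  have : ∀ K : List (ℤ × V × ℚ), (∀ e ∈ K, 1 ≤ e.1) → (K.length : ℤ) ≤ listWeight K := by
    intro K hK
    induction K with
    | nil => simp
    | cons e K ih =>
      have := ih fun x hx => hK x (by simp [hx])
      have := hK e (by simp)
      simp
      omega
  exact this L fun e he => hX _ (h.mem e he)

theorem deficit_le (h : IsReducedList X T N L) (hX : ∀ e ∈ X, 1 ≤ e.1) :
    listDeficit N L ≤ listDegree L + L.length * N := by
  have : (L.length : ℚ) ≤ listWeight L := by exact_mod_cast h.length_le_weight hX
  rw [listDeficit_eq]
  linarith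

theorem length_mul_le (h : IsReducedList X T N L) (hX : ∀ e ∈ X, 1 ≤ e.1) :
    (L.length : ℚ) * (L.length - 1 - 2 * N) ≤ 2 * listDegree L := by
  have h1 := h.length_mul_le_deficit
  have h2 := h.deficit_le hX
  linarith

/-- Completes the square in the length. The bound is not sharp, but it is an integer when N is. -/
theorem neg_le_degree (h : IsReducedList X T N L) (hX : ∀ e ∈ X, 1 ≤ e.1) :
    -(2 * N + 1) ^ 2 ≤ listDegree L := by
  nlinarith [h.length_mul_le hX, sq_nonneg (2 * (L.length : ℚ) - (2 * N + 1)),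
    sq_nonneg (2 * N + 1)]

theorem length_le (h : IsReducedList X T N L) (hN : 0 ≤ N) (hX : ∀ e ∈ X, 1 ≤ e.1) :
    (L.length : ℚ) ≤ 2 * N + 2 + 2 * |listDegree L| := by
  by_contra! hlt
  have h1 := abs_nonneg (listDegree L)
  have h2 := le_abs_self (listDegree L)
  nlinarith [h.length_mul_le hX]

theorem exists_degree_eq (h : IsReducedList X T N L) (hT : 0 < T) :
    ∃ l : ℤ, listDegree L = l / T := by
  have hT' : (T : ℚ) ≠ 0 := by exact_mod_cast hT.ne'
  have : ∀ K : List (ℤ × V × ℚ), (∀ e ∈ K, ∃ n : ℤ, e.2.2 = n / T) →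
      ∃ l : ℤ, listDegree K = l / T := by
    intro K hK
    induction K with
    | nil => exact ⟨0, by simp⟩
    | cons e K ih =>
      obtain ⟨l, hl⟩ := ih fun x hx => hK x (by simp [hx])
      obtain ⟨n, hn⟩ := hK e (by simp)
      refine ⟨(e.1 - 1) * T - n + l, ?_⟩
      rw [listDegree_cons, hl, hn]
      push_cast
      field_simp
      ring
  exact this L h.frac

end IsReducedList

theorem Set.Finite.lists_length_le {α : Type*} {E : Set α} (hE : E.Finite) (k : ℕ) :
    {L : List α | L.length ≤ k ∧ ∀ e ∈ L, e ∈ E}.Finite := by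
  have : Finite E := hE
  refine ((List.finite_length_le E k).image (List.map Subtype.val)).subset ?_
  rintro L ⟨hk, hL⟩
  lift L to List E using hL
  exact ⟨L, by simpa using hk, rfl⟩

theorem finite_isReducedList (hXfin : X.Finite) (hX : ∀ e ∈ X, 1 ≤ e.1) (hT : 0 < T) (hN : 0 ≤ N)
    (d : ℚ) : {L | IsReducedList X T N L ∧ listDegree L = d}.Finite := by
  have hT' : (0 : ℚ) < T := by exact_mod_cast hT
  obtain ⟨k, hk⟩ := exists_nat_ge (2 * N + 2 + 2 * |d|)
  -- Deficits are nonnegative, so each is at most their sum, which is at most d + kN; hence every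
  -- index lies between N - d - kN and N.
  let E : Set (ℤ × V × ℚ) := (fun p : (ℤ × V) × ℤ => (p.1.1, p.1.2, (p.2 : ℚ) / T)) ''
    (X ×ˢ Set.Icc ⌊(N - d - k * N) * T⌋ ⌈N * T⌉)
  have hE : E.Finite := (hXfin.prod (Set.finite_Icc _ _)).image _
  refine (hE.lists_length_le k).subset ?_
  rintro L ⟨hL, rfl⟩
  have hlen : (L.length : ℚ) ≤ k := (hL.length_le hN hX).trans hk
  refine ⟨by exact_mod_cast hlen, fun e he => ?_⟩
  obtain ⟨n, hn⟩ := hL.frac e he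
  refine ⟨((e.1, e.2.1), n), ⟨hL.mem e he, ?_, ?_⟩, by simp [← hn]⟩
  · have h1 : N - e.2.2 ≤ listDeficit N L := by
      refine List.single_le_sum (fun x hx => ?_) _ (List.mem_map.2 ⟨e, he, rfl⟩)
      obtain ⟨f, hf, rfl⟩ := List.mem_map.1 hx
      linarith [hL.lt f hf]
    have h2 := hL.deficit_le hX
    have h3 : (L.length : ℚ) * N ≤ k * N := mul_le_mul_of_nonneg_right hlen hN
    have h4 : (N - listDegree L - k * N) * T ≤ n := by
      rw [← le_div_iff₀ hT', ← hn]
      linarith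
    exact_mod_cast (Int.floor_le _).trans h4
  · have h1 : (n : ℚ) ≤ N * T := by
      rw [← div_le_iff₀ hT', ← hn]
      exact (hL.lt e he).le
    exact_mod_cast h1.trans (Int.le_ceil _)

end ModeLists

/-! ### Finiteness of the degree spaces -/

namespace WeakTwistedModule

/-- The span of the monomials of degree `d`, applied to `w`. -/
def degreeSpace (M : WeakTwistedModule S g W) (w : W) (d : ℚ) : Submodule ℂ W :=
  Submodule.span ℂ {x | ∃ L, S.IsHomogeneousList L ∧ listDegree L = d ∧ x = M.monomial L w}

theorem degreeSpace_finite (M : WeakTwistedModule S g W) (hg : S.IsAutomorphism g)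
    (hfin : IsOfFinOrder g) (hCFT : S.IsCFTType) (hC2 : S.IsC2Cofinite) (w : W) :
    (∀ d, FiniteDimensional ℂ (M.degreeSpace w d)) ∧
      ∃ K : ℕ, ∀ d, M.degreeSpace w d ≠ ⊥ → ∃ k : ℕ, d = (k : ℚ) / orderOf g - K := by
  obtain ⟨X, hXfin, hX, hgen⟩ := S.exists_finite_generators hg hfin hCFT hC2
  have hT := hfin.orderOf_pos
  have hT' : (0 : ℚ) < orderOf g := by exact_mod_cast hT
  obtain ⟨N, hN⟩ : ∃ N : ℕ, ∀ e ∈ X, ∀ q : ℚ, (N : ℚ) ≤ q → M.Y e.2 q w = 0 := by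
    choose B hB using fun a => M.truncation a w
    obtain ⟨b, hb⟩ := (hXfin.image fun e => B e.2).bddAbove
    obtain ⟨N, hN⟩ := exists_nat_ge b
    exact ⟨N, fun e he q hq => hB _ q (((hb ⟨e, he, rfl⟩).trans hN).trans hq)⟩
  have hX1 : ∀ e ∈ X, 1 ≤ e.1 := fun e he => (hX e he).1
  have hle : ∀ d, M.degreeSpace w d ≤ M.reducedSpan w X N d := by
    intro d
    refine Submodule.span_le.2 ?_
    rintro _ ⟨L, hL, rfl, rfl⟩
    exact monomial_mem_reducedSpan hfin hCFT hX hgen hN hL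
  refine ⟨fun d => ?_, (2 * N + 1) ^ 2, fun d hd => ?_⟩
  · have : FiniteDimensional ℂ (M.reducedSpan w X N d) := by
      refine FiniteDimensional.span_of_finite ℂ
        (((finite_isReducedList hXfin hX1 hT (Nat.cast_nonneg N) d).image
          fun L => M.monomial L w).subset ?_)
      rintro _ ⟨L, hL, hd, rfl⟩
      exact ⟨L, ⟨hL, hd⟩, rfl⟩
    exact Submodule.finiteDimensional_of_le (hle d)
  · have : ∃ L, IsReducedList X (orderOf g) N L ∧ listDegree L = d := by
      by_contra! hno
      refine hd (eq_bot_iff.2 ((hle d).trans (Submodule.span_le.2 ?_)))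
      rintro _ ⟨L, hL, hLd, rfl⟩
      exact absurd hLd (hno L hL)
    obtain ⟨L, hL, rfl⟩ := this
    obtain ⟨l, hl⟩ := hL.exists_degree_eq hT
    have h1 := hL.neg_le_degree hX1
    rw [hl, le_div_iff₀ hT'] at h1
    have h2 : 0 ≤ l + (2 * N + 1) ^ 2 * (orderOf g : ℤ) := by
      have : (0 : ℚ) ≤ l + (2 * N + 1) ^ 2 * (orderOf g : ℤ) := by push_cast; linarith
      exact_mod_cast this
    obtain ⟨k, hk⟩ := Int.eq_ofNat_of_zero_le h2
    refine ⟨k, ?_⟩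
    have hk' : (l : ℚ) + (2 * N + 1) ^ 2 * (orderOf g) = k := by exact_mod_cast hk
    rw [hl, ← hk']
    push_cast
    field_simp
    ring

end WeakTwistedModule

/-! ### Independent families of subspaces -/

section Lattice

variable {W : Type*} [AddCommGroup W] [Module ℂ W] {ι : Type*}

theorem iSupIndep.comap_subtype {A : ι → Submodule ℂ W} (hA : iSupIndep A) (N : Submodule ℂ W) :
    iSupIndep fun i => (A i).comap N.subtype := by
  intro i
  rw [Submodule.disjoint_def]
  intro x hx hx'
  have h1 : N.subtype x ∈ ⨆ j, ⨆ (_ : j ≠ i), A j := by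
    have := Submodule.mem_map_of_mem (f := N.subtype) hx'
    simp only [Submodule.map_iSup] at this
    exact (iSup₂_mono fun j _ => Submodule.map_comap_le _ _) this
  exact Subtype.ext (Submodule.disjoint_def.1 (hA i) _ hx h1)

theorem iSup_comap_subtype_eq_top {A : ι → Submodule ℂ W} {N : Submodule ℂ W} (hA : ⨆ i, A i = N) :
    ⨆ i, (A i).comap N.subtype = ⊤ := by
  apply Submodule.map_injective_of_injective N.injective_subtype
  rw [Submodule.map_iSup, Submodule.map_top, Submodule.range_subtype]
  conv_rhs => rw [← hA]
  refine iSup_congr fun i => ?_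
  rw [Submodule.map_comap_subtype]
  exact inf_eq_right.2 (hA ▸ le_iSup A i)

/-- Used to identify weight spaces with degree spaces once one inclusion is known. -/
theorem iSupIndep.eq_of_le_of_iSup_eq_top {A B : ι → Submodule ℂ W} (hA : iSupIndep A)
    (hBA : ∀ i, B i ≤ A i) (hB : ⨆ i, B i = ⊤) (i : ι) : A i = B i := by
  refine le_antisymm (fun x hx => ?_) (hBA i)
  have hle : (⊤ : Submodule ℂ W) ≤ B i ⊔ ⨆ j, ⨆ (_ : j ≠ i), A j := by
    rw [← hB]
    refine iSup_le fun j => ?_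
    rcases eq_or_ne j i with rfl | hj
    · exact le_sup_left
    · exact (hBA j).trans
        (le_trans (le_iSup₂_of_le (f := fun j (_ : j ≠ i) => A j) j hj le_rfl) le_sup_right)
  obtain ⟨y, hy, z, hz, rfl⟩ := Submodule.mem_sup.1 (hle (Submodule.mem_top (x := x)))
  have hz' : z ∈ A i := by simpa using sub_mem hx (hBA i hy)
  rw [Submodule.disjoint_def.1 (hA i) z hz' hz, add_zero]
  exact hy

end Lattice

/-! ### Cyclic submodules and the action of L(0) -/

namespace WeakTwistedModule

variable (M : WeakTwistedModule S g W)

theorem mode_mem_of_homogeneous {N : Submodule ℂ W} {x : W}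
    (h : ∀ (k : ℤ), ∀ a ∈ S.weightSpace k, ∀ q : ℚ, M.Y a q x ∈ N) (a : V) (q : ℚ) :
    M.Y a q x ∈ N := by
  have ha : a ∈ ⨆ k, S.weightSpace k := S.iSup_weightSpace_eq_top ▸ Submodule.mem_top
  exact (iSup_le fun k a ha => h k a ha q :
    _ ≤ N.comap (LinearMap.applyₗ x ∘ₗ LinearMap.proj q ∘ₗ M.Y)) ha

theorem mem_degreeSpace_zero (u : W) : u ∈ M.degreeSpace u 0 :=
  Submodule.subset_span ⟨[], by simp, rfl, rfl⟩

variable {M}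

theorem mode_mem_degreeSpace {u x : W} {d : ℚ} (hx : x ∈ M.degreeSpace u d) {a : V} {h : ℤ}
    (ha : a ∈ S.weightSpace h) (q : ℚ) : M.Y a q x ∈ M.degreeSpace u (d + h - q - 1) := by
  refine (Submodule.span_le.2 ?_ : _ ≤ (M.degreeSpace u (d + h - q - 1)).comap (M.Y a q)) hx
  rintro _ ⟨L, hL, rfl, rfl⟩
  exact Submodule.subset_span ⟨(h, a, q) :: L, by simp [ha, hL], by simp; ring, by simp⟩

theorem conformal_mem_degreeSpace {u x : W} {d : ℚ} (hx : x ∈ M.degreeSpace u d) :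
    M.Y S.conformal 1 x ∈ M.degreeSpace u d := by
  have := mode_mem_degreeSpace hx S.conformal_mem_weightSpace 1
  rwa [show d + (2 : ℤ) - 1 - 1 = d by push_cast; ring] at this

theorem degreeSpace_le_of_mode_mem {u : W} {F : ℚ → Submodule ℂ W} (hu : u ∈ F 0)
    (hF : ∀ (h : ℤ), ∀ a ∈ S.weightSpace h, ∀ (q d : ℚ), ∀ x ∈ F d,
      M.Y a q x ∈ F (d + h - q - 1)) (d : ℚ) : M.degreeSpace u d ≤ F d := by
  refine Submodule.span_le.2 ?_
  rintro _ ⟨L, hL, rfl, rfl⟩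
  induction L with
  | nil => simpa using hu
  | cons e L ih =>
    rw [S.isHomogeneousList_cons] at hL
    have := hF _ _ hL.1 e.2.2 _ _ (ih hL.2)
    rw [listDegree_cons, show (e.1 - e.2.2 - 1 : ℚ) + listDegree L = listDegree L + e.1 - e.2.2 - 1
      by ring]
    simpa using this

variable (M) in
/-- The submodule generated by `u`. -/
def generate (u : W) : Submodule ℂ W := ⨆ d, M.degreeSpace u d

theorem generate_isSubmodule (u : W) : M.IsSubmodule (M.generate u) := by
  intro a q x hx
  refine (iSup_le fun d x hx => ?_ : _ ≤ (M.generate u).comap (M.Y a q)) hx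
  exact M.mode_mem_of_homogeneous (fun k a ha q =>
    Submodule.mem_iSup_of_mem _ (mode_mem_degreeSpace hx ha q)) a q

theorem mem_generate (u : W) : u ∈ M.generate u :=
  Submodule.mem_iSup_of_mem 0 (M.mem_degreeSpace_zero u)

theorem degreeSpace_le {u : W} {N : Submodule ℂ W} (hN : M.IsSubmodule N) (hu : u ∈ N) (d : ℚ) :
    M.degreeSpace u d ≤ N :=
  degreeSpace_le_of_mode_mem (F := fun _ => N) hu (fun _ a _ q _ x hx => hN a q x hx) d

theorem generate_le {u : W} {N : Submodule ℂ W} (hN : M.IsSubmodule N) (hu : u ∈ N) :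
    M.generate u ≤ N :=
  iSup_le fun d => degreeSpace_le hN hu d

theorem mode_mem_genEigenspace (hg : S.IsAutomorphism g) (hfin : IsOfFinOrder g) {a : V} {h : ℤ}
    (ha : a ∈ S.weightSpace h) (q : ℚ) {s : ℂ} {k : ℕ∞} {x : W}
    (hx : x ∈ (M.Y S.conformal 1).genEigenspace s k) :
    M.Y a q x ∈ (M.Y S.conformal 1).genEigenspace (s + ((h : ℂ) - q - 1)) k := by
  rw [Module.End.mem_genEigenspace] at *
  obtain ⟨l, hl, hx⟩ := hx
  refine ⟨l, hl, ?_⟩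
  have : SemiconjBy (M.Y a q) (M.Y S.conformal 1 - s • 1)
      (M.Y S.conformal 1 - (s + ((h : ℂ) - q - 1)) • 1) := by
    ext w
    have := M.commutator_conformal_one hg hfin ha q w
    rw [sub_eq_iff_eq_add] at this
    simp only [Module.End.mul_apply, LinearMap.sub_apply, LinearMap.smul_apply, Module.End.one_apply,
      map_sub, map_smul, this]
    module
  have e := congrArg (fun f : Module.End ℂ W => f x) (this.pow_right l).eq
  simp only [Module.End.mul_apply, LinearMap.mem_ker.1 hx, map_zero] at e
  exact LinearMap.mem_ker.2 e.symm

theorem degreeSpace_le_genEigenspace (hg : S.IsAutomorphism g) (hfin : IsOfFinOrder g) {s : ℂ}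
    {k : ℕ∞} {u : W} (hu : u ∈ (M.Y S.conformal 1).genEigenspace s k) (d : ℚ) :
    M.degreeSpace u d ≤ (M.Y S.conformal 1).genEigenspace (s + d) k := by
  refine degreeSpace_le_of_mode_mem
    (F := fun d : ℚ => (M.Y S.conformal 1).genEigenspace (s + d) k) (by simpa using hu) ?_ d
  intro h a ha q d x hx
  rw [show s + ((d + h - q - 1 : ℚ) : ℂ) = s + d + ((h : ℂ) - q - 1) by push_cast; ring]
  exact mode_mem_genEigenspace hg hfin ha q hx

/-- The degree-0 space of w is finite-dimensional, L(0)-stable and contains w; over ℂ it is the sum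
of generalized eigenspaces. -/
theorem mem_iSup_maxGenEigenspace (hg : S.IsAutomorphism g)
    (hfin : IsOfFinOrder g) (hCFT : S.IsCFTType) (hC2 : S.IsC2Cofinite) (w : W) :
    w ∈ ⨆ s, (M.Y S.conformal 1).maxGenEigenspace s := by
  have hU := (M.degreeSpace_finite hg hfin hCFT hC2 w).1 0
  let f : Module.End ℂ (M.degreeSpace w 0) := (M.Y S.conformal 1).restrict
    (p := M.degreeSpace w 0) fun x hx => conformal_mem_degreeSpace hx
  have h1 : (⟨w, M.mem_degreeSpace_zero w⟩ : M.degreeSpace w 0) ∈ ⨆ s, f.maxGenEigenspace s := by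
    rw [Module.End.iSup_maxGenEigenspace_eq_top]
    exact Submodule.mem_top
  have h2 := Submodule.mem_map_of_mem (f := (M.degreeSpace w 0).subtype) h1
  rw [Submodule.map_iSup] at h2
  refine SetLike.le_def.1 (iSup_mono fun s => ?_) h2
  rw [Module.End.maxGenEigenspace, Module.End.genEigenspace_restrict]
  exact Submodule.map_comap_le _ _

theorem exists_eigenvector (hg : S.IsAutomorphism g)
    (hfin : IsOfFinOrder g) (hCFT : S.IsCFTType) (hC2 : S.IsC2Cofinite) {w : W} (hw : w ≠ 0) :
    ∃ s, ∃ u ∈ M.degreeSpace w 0, u ≠ 0 ∧ u ∈ M.weightSpace s := by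
  have hU := (M.degreeSpace_finite hg hfin hCFT hC2 w).1 0
  have : Nontrivial (M.degreeSpace w 0) :=
    ⟨⟨w, M.mem_degreeSpace_zero w⟩, 0, fun e => hw (congrArg Subtype.val e)⟩
  obtain ⟨s, hs⟩ := Module.End.exists_eigenvalue ((M.Y S.conformal 1).restrict
    (p := M.degreeSpace w 0) fun x hx => conformal_mem_degreeSpace hx)
  obtain ⟨u, hu⟩ := hs.exists_hasEigenvector
  refine ⟨s, u, u.2, fun e => hu.2 (Subtype.ext e), ?_⟩
  have := congrArg Subtype.val hu.apply_eq_smul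
  exact Module.End.mem_eigenspace_iff.2 this

theorem generate_isAdmissible (hg : S.IsAutomorphism g)
    (hfin : IsOfFinOrder g) (hCFT : S.IsCFTType) (hC2 : S.IsC2Cofinite) {u : W} {s : ℂ}
    (hu : u ∈ (M.Y S.conformal 1).maxGenEigenspace s) :
    (M.restrict (M.generate u) (generate_isSubmodule u)).IsAdmissible := by
  obtain ⟨-, K, hK⟩ := M.degreeSpace_finite hg hfin hCFT hC2 u
  -- The shift by K moves the lowest possible degree -K to 0.
  refine ⟨fun q => (M.degreeSpace u (q - K)).comap (M.generate u).subtype, ?_, ?_, ?_⟩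
  · rw [DirectSum.isInternal_submodule_iff_iSupIndep_and_iSup_eq_top]
    constructor
    · refine iSupIndep.comap_subtype ?_ _
      have hinj : Function.Injective fun q : ℚ => s + ((q - K : ℚ) : ℂ) := fun p q h => by
        simpa using h
      exact (((M.Y S.conformal 1).independent_maxGenEigenspace).comp hinj).mono fun q =>
        degreeSpace_le_genEigenspace hg hfin hu (q - K)
    · exact iSup_comap_subtype_eq_top ((Equiv.subRight (K : ℚ)).iSup_comp (g := M.degreeSpace u))
  · intro q hq
    by_contra hne
    have : M.degreeSpace u (q - K) ≠ ⊥ := by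
      intro e
      refine hne ?_
      simp only [e]
      exact (LinearMap.ker_eq_bot.2 (M.generate u).injective_subtype)
    obtain ⟨k, hk⟩ := hK _ this
    exact hq k (by linarith)
  · intro h a ha m q x hx
    have := mode_mem_degreeSpace (Submodule.mem_comap.1 hx) ha m
    rw [show q - K + h - m - 1 = q + h - m - 1 - K by ring] at this
    exact this

/-- A true eigenvector u forces each degree space into one eigenspace. The degree spaces span and
eigenspaces are independent, so nothing else fits. -/
theorem weightSpace_of_generate_eq_top (hg : S.IsAutomorphism g) (hfin : IsOfFinOrder g) {u : W}
    {s : ℂ} (hu : u ∈ M.weightSpace s) (htop : M.generate u = ⊤) :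
    (∀ d : ℚ, M.weightSpace (s + d) = M.degreeSpace u d) ∧
      ∀ t, M.weightSpace t ≠ ⊥ → ∃ d : ℚ, t = s + d := by
  let B : ℂ → Submodule ℂ W := fun t => ⨆ (d : ℚ), ⨆ (_ : s + d = t), M.degreeSpace u d
  have hle : ∀ d : ℚ, M.degreeSpace u d ≤ M.weightSpace (s + d) := fun d =>
    degreeSpace_le_genEigenspace hg hfin hu d
  have hB : ∀ t, M.weightSpace t = B t := by
    refine iSupIndep.eq_of_le_of_iSup_eq_top (M.Y S.conformal 1).eigenspaces_iSupIndep
      (fun t => iSup₂_le ?_) ?_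
    · rintro d rfl
      exact hle d
    · rw [eq_top_iff, ← htop]
      exact iSup_le fun d => le_iSup_of_le (s + d) (le_iSup₂_of_le d rfl le_rfl)
  refine ⟨fun d => le_antisymm ?_ (hle d), fun t ht => ?_⟩
  · rw [hB]
    refine iSup₂_le fun e he => ?_
    have : e = d := by simpa using he
    rw [this]
  · by_contra! hno
    refine ht ?_
    rw [hB, eq_bot_iff]
    exact iSup₂_le fun d hd => absurd hd.symm (hno d)

theorem IsIrreducible.isOrdinary (hg : S.IsAutomorphism g)
    (hfin : IsOfFinOrder g) (hCFT : S.IsCFTType) (hC2 : S.IsC2Cofinite) (hM : M.IsIrreducible) :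
    M.IsOrdinary := by
  obtain ⟨hW, hirr⟩ := hM
  obtain ⟨w, hw⟩ := exists_ne (0 : W)
  obtain ⟨s, u, -, hu0, hu⟩ := exists_eigenvector (M := M) hg hfin hCFT hC2 hw
  have htop : M.generate u = ⊤ := (hirr _ (generate_isSubmodule u)).resolve_left fun e =>
    hu0 ((Submodule.eq_bot_iff _).1 e u (mem_generate u))
  obtain ⟨h1, h2⟩ := weightSpace_of_generate_eq_top hg hfin hu htop
  obtain ⟨hfd, K, hK⟩ := M.degreeSpace_finite hg hfin hCFT hC2 u
  have hT : (0 : ℚ) < orderOf g := by exact_mod_cast hfin.orderOf_pos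
  refine ⟨?_, fun t => ?_, fun t => ?_⟩
  · rw [DirectSum.isInternal_submodule_iff_iSupIndep_and_iSup_eq_top]
    refine ⟨(M.Y S.conformal 1).eigenspaces_iSupIndep, ?_⟩
    rw [eq_top_iff, ← htop]
    exact iSup_le fun d => (h1 d).ge.trans (le_iSup M.weightSpace (s + d))
  · by_cases ht : M.weightSpace t = ⊥
    · rw [ht]
      infer_instance
    · obtain ⟨d, rfl⟩ := h2 t ht
      rw [h1]
      exact hfd d
  · by_cases ht : ∃ d : ℚ, t = s + d
    · obtain ⟨d, rfl⟩ := ht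
      refine ⟨-⌈(K + d) * orderOf g⌉, fun n hn => ?_⟩
      by_contra hne
      rw [show s + (d : ℂ) + (n : ℂ) / orderOf g = s + ((d + n / orderOf g : ℚ) : ℂ) by
        push_cast; ring, h1] at hne
      obtain ⟨k, hk⟩ := hK _ hne
      have h3 : -(K + d) ≤ n / orderOf g := by
        have : (0 : ℚ) ≤ k / orderOf g := by positivity
        linarith
      rw [le_div_iff₀ hT] at h3
      have h4 : -⌈(K + d) * orderOf g⌉ ≤ n := by
        have h5 : ((-n : ℤ) : ℚ) ≤ (⌈(K + d) * orderOf g⌉ : ℤ) := by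
          push_cast
          linarith [Int.le_ceil ((K + d) * (orderOf g : ℚ))]
        rw [neg_le]
        exact_mod_cast h5
      omega
    -- All weights lie in s + ℚ; if t does not, neither does any t + n/|g|, and any bound serves.
    · refine ⟨0, fun n _ => ?_⟩
      by_contra hne
      obtain ⟨d, hd⟩ := h2 _ hne
      exact ht ⟨d - n / orderOf g, by push_cast; linear_combination hd⟩

/-- A homogeneous L(0)-eigenvector u generates the module, so every L(0)-eigenspace is a degree
space of u and lies in a single graded piece. An L(0)-eigenvector in an arbitrary nonzero submodule
is then homogeneous, and graded irreducibility makes it generate everything. -/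
theorem IsIrreducibleAdmissible.isIrreducible (hg : S.IsAutomorphism g)
    (hfin : IsOfFinOrder g) (hCFT : S.IsCFTType) (hC2 : S.IsC2Cofinite)
    (hM : M.IsIrreducibleAdmissible) : M.IsIrreducible := by
  obtain ⟨hW, gr, hgr, hirr⟩ := hM
  refine ⟨hW, ?_⟩
  have hle : ∀ {u : W} {q : ℚ}, u ∈ gr q → ∀ d, M.degreeSpace u d ≤ gr (q + d) := by
    intro u q hu
    refine degreeSpace_le_of_mode_mem (F := fun d => gr (q + d)) (by simpa using hu) ?_
    intro h a ha m d x hx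
    have := hgr.mode_mem h a ha m _ x hx
    convert this using 2
    ring
  have hgen : ∀ {u : W} {q : ℚ}, u ≠ 0 → u ∈ gr q → M.generate u = ⊤ := by
    intro u q hu0 hu
    refine (hirr _ (generate_isSubmodule u) (le_antisymm ?_
      (iSup_le fun _ => inf_le_left))).resolve_left
      fun e => hu0 ((Submodule.eq_bot_iff _).1 e u (mem_generate u))
    exact iSup_le fun d => le_iSup_of_le (q + d) (le_inf (le_iSup _ d) (hle hu d))
  obtain ⟨q, hq⟩ : ∃ q, gr q ≠ ⊥ := by
    by_contra! hno
    have := hgr.internal.submodule_iSup_eq_top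
    rw [iSup_eq_bot.2 hno] at this
    exact bot_ne_top this
  obtain ⟨w, hw, hw0⟩ := Submodule.exists_mem_ne_zero_of_ne_bot hq
  obtain ⟨s, u, huw, hu0, hu⟩ := exists_eigenvector (M := M) hg hfin hCFT hC2 hw0
  have huq : u ∈ gr q := by simpa using hle hw 0 huw
  obtain ⟨h1, h2⟩ := weightSpace_of_generate_eq_top hg hfin hu (hgen hu0 huq)
  intro N hN
  refine or_iff_not_imp_left.2 fun hN0 => ?_
  obtain ⟨x, hx, hx0⟩ := Submodule.exists_mem_ne_zero_of_ne_bot hN0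
  obtain ⟨t, y, hyx, hy0, hy⟩ := exists_eigenvector (M := M) hg hfin hCFT hC2 hx0
  obtain ⟨d, rfl⟩ := h2 t ((Submodule.ne_bot_iff _).2 ⟨y, hy, hy0⟩)
  rw [h1] at hy
  rw [eq_top_iff, ← hgen hy0 (hle huq d hy)]
  exact generate_le hN (degreeSpace_le hN hx 0 hyx)

end WeakTwistedModule

/-! ### Semisimplicity over the algebra of modes -/

namespace WeakTwistedModule

variable (M : WeakTwistedModule S g W)

/-- The algebra of operators on `W` generated by the modes. -/
def modeAlgebra : Subalgebra ℂ (Module.End ℂ W) :=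
  Algebra.adjoin ℂ {f | ∃ (a : V) (q : ℚ), f = M.Y a q}

theorem modeAlgebra_apply_mem {N : Submodule ℂ W} (hN : M.IsSubmodule N) {f : Module.End ℂ W}
    (hf : f ∈ M.modeAlgebra) : ∀ x ∈ N, f x ∈ N := by
  induction hf using Algebra.adjoin_induction with
  | mem f hf =>
    obtain ⟨a, q, rfl⟩ := hf
    exact hN a q
  | algebraMap c => exact fun x hx => N.smul_mem c hx
  | add f h _ _ hf hh => exact fun x hx => N.add_mem (hf x hx) (hh x hx)
  | mul f h _ _ hf hh => exact fun x hx => hf _ (hh x hx)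

variable {M}

/-- A submodule of a weak module, as a submodule over the algebra of modes. -/
def IsSubmodule.toModeAlgebra {N : Submodule ℂ W} (hN : M.IsSubmodule N) :
    Submodule M.modeAlgebra W where
  carrier := N
  add_mem' := N.add_mem
  zero_mem' := N.zero_mem
  smul_mem' f x hx := M.modeAlgebra_apply_mem hN f.2 x hx

theorem isSubmodule_restrictScalars (P : Submodule M.modeAlgebra W) :
    M.IsSubmodule (P.restrictScalars ℂ) := fun a q _ hx =>
  P.smul_mem (⟨M.Y a q, Algebra.subset_adjoin ⟨a, q, rfl⟩⟩ : M.modeAlgebra) hx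

theorem isIrreducible_restrict_iff {N : Submodule ℂ W} (hN : M.IsSubmodule N) :
    (M.restrict N hN).IsIrreducible ↔
      N ≠ ⊥ ∧ ∀ N' ≤ N, M.IsSubmodule N' → N' = ⊥ ∨ N' = N := by
  rw [IsIrreducible, Submodule.nontrivial_iff_ne_bot]
  refine and_congr_right fun _ => ⟨fun h N' hle hN' => ?_, fun h P hP => ?_⟩
  · refine (h (N'.comap N.subtype) fun a q x hx => hN' a q _ hx).imp (fun e => ?_) fun e => ?_
    · have := congrArg (Submodule.map N.subtype) e
      rwa [Submodule.map_comap_subtype, Submodule.map_bot, inf_eq_right.2 hle] at this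
    · have := congrArg (Submodule.map N.subtype) e
      rwa [Submodule.map_comap_subtype, Submodule.map_top, Submodule.range_subtype,
        inf_eq_right.2 hle] at this
  · refine (h (P.map N.subtype) (Submodule.map_subtype_le N P) ?_).imp (fun e => ?_) fun e => ?_
    · rintro a q _ ⟨x, hx, rfl⟩
      exact ⟨_, hP a q x hx, rfl⟩
    · exact Submodule.map_injective_of_injective N.injective_subtype (by rw [e, Submodule.map_bot])
    · apply Submodule.map_injective_of_injective N.injective_subtype
      rw [e, Submodule.map_top, Submodule.range_subtype]

theorem IsSubmodule.map_subtype {N : Submodule ℂ W} (hN : M.IsSubmodule N) {P : Submodule ℂ N}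
    (hP : (M.restrict N hN).IsSubmodule P) : M.IsSubmodule (P.map N.subtype) := by
  rintro a q _ ⟨x, hx, rfl⟩
  exact ⟨_, hP a q x hx, rfl⟩

theorem isIrreducible_restrict_map_subtype {N : Submodule ℂ W} (hN : M.IsSubmodule N)
    {P : Submodule ℂ N} (hP : (M.restrict N hN).IsSubmodule P)
    (hirr : ((M.restrict N hN).restrict P hP).IsIrreducible) :
    (M.restrict _ (hN.map_subtype hP)).IsIrreducible := by
  rw [isIrreducible_restrict_iff] at *
  refine ⟨fun e => hirr.1
    (Submodule.map_injective_of_injective N.injective_subtype (by rw [e, Submodule.map_bot])),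
    fun Q hQ hQM => ?_⟩
  have hQN : N ⊓ Q = Q := inf_eq_right.2 (hQ.trans (Submodule.map_subtype_le N P))
  have hle : Q.comap N.subtype ≤ P := by
    rw [← Submodule.comap_map_eq_of_injective N.injective_subtype P]
    exact Submodule.comap_mono hQ
  have hmap : (Q.comap N.subtype).map N.subtype = Q := by rw [Submodule.map_comap_subtype, hQN]
  refine (hirr.2 _ hle fun a q x hx => hQM a q _ hx).imp (fun e => ?_) fun e => ?_
  · rw [← hmap, e, Submodule.map_bot]
  · rw [← hmap, e]

theorem isSimpleModule_of_isIrreducible {N : Submodule ℂ W} (hN : M.IsSubmodule N)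
    (hirr : (M.restrict N hN).IsIrreducible) : IsSimpleModule M.modeAlgebra hN.toModeAlgebra := by
  rw [isIrreducible_restrict_iff] at hirr
  rw [isSimpleModule_iff_isAtom]
  refine ⟨fun e => hirr.1 ?_, fun P hP => ?_⟩
  · rw [Submodule.eq_bot_iff] at e ⊢
    exact e
  · have hle : P.restrictScalars ℂ ≤ N := hP.le
    rcases hirr.2 _ hle (isSubmodule_restrictScalars P) with e | e
    · exact (Submodule.restrictScalars_eq_bot_iff _ _ _).1 e
    · exact absurd (fun x (hx : x ∈ N) => (e ▸ hx : x ∈ P.restrictScalars ℂ)) hP.not_ge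

theorem isIrreducible_of_isSimpleModule {P : Submodule M.modeAlgebra W}
    (hP : IsSimpleModule M.modeAlgebra P) :
    (M.restrict _ (isSubmodule_restrictScalars P)).IsIrreducible := by
  rw [isIrreducible_restrict_iff]
  rw [isSimpleModule_iff_isAtom] at hP
  refine ⟨fun e => hP.1 ((Submodule.restrictScalars_eq_bot_iff _ _ _).1 e), fun N hle hN => ?_⟩
  refine (hP.le_iff.1 (show hN.toModeAlgebra ≤ P from hle)).imp (fun e => ?_) fun e => ?_
  · rw [Submodule.eq_bot_iff] at e ⊢
    exact e
  · rw [← e]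
    rfl

theorem exists_isInternal_of_isSemisimpleModule [IsSemisimpleModule M.modeAlgebra W] :
    ∃ s : Set (Submodule M.modeAlgebra W), (∀ P ∈ s, IsSimpleModule M.modeAlgebra P) ∧
      iSupIndep (fun P : s => (P : Submodule M.modeAlgebra W).restrictScalars ℂ) ∧
      ⨆ P : s, (P : Submodule M.modeAlgebra W).restrictScalars ℂ = ⊤ := by
  obtain ⟨s, hind, htop, hs⟩ :=
    IsSemisimpleModule.exists_sSupIndep_sSup_simples_eq_top M.modeAlgebra W
  classical
  refine ⟨s, hs, ?_⟩
  rw [← DirectSum.isInternal_submodule_iff_iSupIndep_and_iSup_eq_top]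
  have : DirectSum.IsInternal fun P : s => (P : Submodule M.modeAlgebra W) := by
    rw [DirectSum.isInternal_submodule_iff_iSupIndep_and_iSup_eq_top]
    exact ⟨(sSupIndep_iff _).1 hind, by rw [← sSup_eq_iSup', htop]⟩
  exact this

/-- It suffices that simple submodules span W. Generalized L(0)-eigenvectors span W, and rationality
puts each of them in a sum of simple submodules of the module it generates. -/
theorem isSemisimpleModule_modeAlgebra (hg : S.IsAutomorphism g)
    (hfin : IsOfFinOrder g) (hCFT : S.IsCFTType) (hC2 : S.IsC2Cofinite)
    (hrat : VertexOperatorAlgebra.IsGRational.{u, v} S g) :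
    IsSemisimpleModule M.modeAlgebra W := by
  classical
  apply IsSemisimpleModule.of_sSup_simples_eq_top
  set Q : Submodule M.modeAlgebra W := sSup {m | IsSimpleModule M.modeAlgebra m}
  rw [eq_top_iff]
  rintro w -
  have hQ : ⨆ s, (M.Y S.conformal 1).maxGenEigenspace s ≤ Q.restrictScalars ℂ := by
    refine iSup_le fun s u hu => ?_
    obtain ⟨ι, N, hN, hint, hirr⟩ := hrat (M.generate u) _
      (generate_isAdmissible hg hfin hCFT hC2 hu)
    have h1 : (⟨u, mem_generate u⟩ : M.generate u) ∈ ⨆ i, N i :=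
      hint.submodule_iSup_eq_top ▸ Submodule.mem_top
    have h2 := Submodule.mem_map_of_mem (f := (M.generate u).subtype) h1
    rw [Submodule.map_iSup] at h2
    refine SetLike.le_def.1 (iSup_le fun i => ?_) h2
    have h3 := isSimpleModule_of_isIrreducible _ (isIrreducible_restrict_map_subtype
      (generate_isSubmodule u) (hN i) ((hirr i).isIrreducible hg hfin hCFT hC2))
    have h4 : IsSubmodule.toModeAlgebra ((generate_isSubmodule u).map_subtype (hN i)) ≤ Q :=
      le_sSup h3
    exact h4
  exact hQ (M.mem_iSup_maxGenEigenspace hg hfin hCFT hC2 w)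

end WeakTwistedModule

theorem mainTheorem4 {V : Type u} [AddCommGroup V] [Module ℂ V]
    (S : VertexOperatorAlgebra V) (g : V ≃ₗ[ℂ] V)
    (hg : S.IsAutomorphism g) (hfin : IsOfFinOrder g)
    (hCFT : S.IsCFTType) (hC2 : S.IsC2Cofinite)
    (hrat : VertexOperatorAlgebra.IsGRational.{u, v} S g) :
    VertexOperatorAlgebra.IsGRegular.{u, v} S g := by
  intro W _ _ M
  have := WeakTwistedModule.isSemisimpleModule_modeAlgebra (M := M) hg hfin hCFT hC2 hrat
  obtain ⟨s, hs, hind, htop⟩ :=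
    WeakTwistedModule.exists_isInternal_of_isSemisimpleModule (M := M)
  refine ⟨s, fun P => (P : Submodule M.modeAlgebra W).restrictScalars ℂ,
    fun P => WeakTwistedModule.isSubmodule_restrictScalars _, ?_, fun P => ?_⟩
  · exact (@DirectSum.isInternal_submodule_iff_iSupIndep_and_iSup_eq_top _ _ _ (_) _ _ _ _).2
      ⟨hind, htop⟩
  · have hirr := WeakTwistedModule.isIrreducible_of_isSimpleModule (hs P P.2)
    exact ⟨hirr, hirr.isOrdinary hg hfin hCFT hC2⟩
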